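/- **Setting.** Work with simply typed terms modulo $\alpha$ over typed function symbols and variables (infinitely many of each type), and with meta-terms, which may also contain meta-variable applications $Z\langle s_1,\dots,s_e\rangle$, where $Z:[\sigma_1\times\dots\times\sigma_k]\to\tau$ has minimal arity $k\le e$. A meta-substitution $\gamma$ is type-preserving with $\gamma(Z)=\lambda y_1\dots y_k.u$; $Z\langle s_1,\dots,s_e\rangle\gamma=t[x_1:=s_1\gamma,\dots,x_e:=s_e\gamma]$ where $\gamma(Z)\approx_e\lambda x_1\dots x_e.t$, i.e. either $\gamma(Z)=\lambda x_1\dots x_e.t$, or $\gamma(Z)=\lambda x_1\dots x_i.t'$ with $i<e$, $t'$ not an abstraction and $t=t'\,x_{i+1}\cdots x_e$. A substitution maps everything in its domain to terms. A pattern is $Z\langle x_1,\dots,x_k\rangle$ with distinct variables and $k$ the minimal arity of $Z$, or $\lambda x.\ell$, or $a\,\ell_1\cdots\ell_n$ with $a$ a function symbol or variable and all $\ell_i$ patterns. A rule $\ell\Rightarrow r$ consists of closed meta-terms of equal type, $\ell=f\,\ell_1\cdots\ell_n$ a pattern, and all meta-variables of $r$ occurring in $\ell$. A set of rules $\mathcal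 R$ gives the monotone rewrite relation $\to_{\mathcal R}$, which includes $\beta$. **Accessibility.** A quasi-ordering $\succeq$ on sorts with well-founded strict part $\succ$ is fixed. For $\sigma=\sigma_1\to\dots\to\sigma_m\to\kappa$: $\iota\succeq_+\sigma$ iff $\iota\succeq\kappa$ and all $\iota\succ_-\sigma_i$; $\iota\succ_-\sigma$ iff $\iota\succ\kappa$ and all $\iota\succeq_+\sigma_i$. For a function symbol $f:\sigma_1\to\dots\to\sigma_m\to\iota$, $\mathit{Acc}(f)=\{i:\iota\succeq_+\sigma_i\}$; for a variable $x$ of such a type, $\mathit{Acc}(x)=\{i:\iota\succeq\text{the output sort of }\sigma_i\}$. Then $s\unrhd_{\mathrm{acc}}t$ iff $s=t$, or $s=\lambda x.s'$ and $s'\unrhd_{\mathrm{acc}}t$, or $s=a\,s_1\cdots s_n$ with $a$ a function symbol or variable and $s_i\unrhd_{\mathrm{acc}}t$ for some $i\in\mathit{Acc}(a)$. **Computability.** An RC-set for $\to_S$ is a set $I$ of $\to_S$-terminating base-type terms, closed under $\to_S$, which contains every base-type term of the form $x\,s_1\cdots s_n$ or $(\lambda x.u)\,s_0\cdots s_n$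 all of whose $\to_S$-reducts are in $I$. A base-type term is $I$-computable iff it is in $I$; a term $s:\sigma\to\tau$ is $I$-computable iff $s\,t$ is for all $I$-computable $t:\sigma$. Write $f\,s_1\cdots s_m\Rrightarrow_I s_i\,t_1\cdots t_n$ if both sides have base type, $i\in\mathit{Acc}(f)$ and all $t_j$ are $I$-computable. For each set $S$ of rules, $C_S$ denotes any RC-set $C$ for $\to_S$ that consists exactly of the base-type terms $s$ which are terminating under $\to_S\cup\Rrightarrow_C$ and such that $s\to_S^*f\,s_1\cdots s_m$ implies that $s_i$ is $C$-computable for all $i\in\mathit{Acc}(f)$. **Chains.** A dependency pair (DP) $\ell\Rrightarrow p\ (A)$ consists of a closed pattern $\ell=f\,\ell_1\cdots\ell_n$ with $n\ge\mathit{ar}(f)$ (for a fixed arity function $\mathit{ar}$), a meta-term $p$, and a set $A$ of conditions $Z:i$. A substitution $\gamma$ respects $A$ if for each $Z:i$ in $A$, $\gamma(Z)\approx_e\lambda x_1\dots x_e.t$ with $x_i\in FV(t)$. The DP is collapsing if $p=Z\langle s_1,\dots,s_e\rangle\,t_1\cdots t_j$. A $(\mathcal P,\mathcal R)$-chain is an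 infinite sequence $(\rho_i,s_i,t_i)_{i\in\mathbb N}$, $\rho_i\in\mathcal P\cup\{\mathtt{beta}\}$, with steps of two kinds (the remaining cases are given below): if $\rho_i=\ell\Rrightarrow p\ (A)$ is non-collapsing, then $s_i=\ell\gamma$ and $t_i=p\gamma$ for a substitution $\gamma$ that respects $A$, has as domain the meta-variables of $\ell$ and $p$ and the free variables of $p$, and maps the latter to fresh variables; and always $t_i=s_{i+1}$, or $t_i=f\,u_1\cdots u_n$ and $s_{i+1}=f\,w_1\cdots w_n$ with all $u_j\to_{\mathcal R}^*w_j$. For a set $B$ of conditions, $s\unrhd_B t$ means that $t$ is reached from $s$ by steps to a head prefix, to the body of an abstraction, to an argument, by $\beta$-reduction at the head, or from $Z\langle t_1,\dots,t_e\rangle\,s_1\cdots s_n$ to some $t_i$ with $(Z:i)\in B$. The chain is $S$-computable if $\to_S\,\supseteq\,\to_{\mathcal R}$ and each $\rho_i$ is a DP $\ell_i\Rrightarrow p_i\ (A_i)$ whose step is realised by a substitution $\gamma_i$ as above with $t_i=p_i\gamma_i$, such that $(\lambda x_1\dots x_n.v)\gamma_i$ is $C_S$-computable whenever $p_i\unrhd_B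 v$, $\gamma_i$ respects $B$ and $FV(v)=\{x_1,\dots,x_n\}$. **Other chain notions** (they enter the notion of DP problem only). Marking $f\mapsto f^\sharp$ is a type- and arity-preserving map on function symbols; $s^\sharp=f^\sharp\,s_1\cdots s_k$ if $s=f\,s_1\cdots s_k$ with $k=\mathit{ar}(f)$, and $s^\sharp=s$ otherwise. If $\rho_i=\mathtt{beta}$, then $s_i=(\lambda x.u)\,v\,w_1\cdots w_n$ and either $n>0$ and $t_i=u[x:=v]\,w_1\cdots w_n$, or $n=0$ and $t_i=q^\sharp[x:=v]$ for a subterm $q\ne x$ of $u$ with $x\in FV(q)$. If $\rho_i=\ell\Rrightarrow p\ (A)$ with $p=Z\langle u_1,\dots,u_e\rangle$, then (with $\gamma$ as above, $s_i=\ell\gamma$) $t_i=v^\sharp[x_1:=u_1\gamma,\dots,x_e:=u_e\gamma]$ for a non-variable subterm $v$ of $w$ containing some $x_j$ free, where $\gamma(Z)\approx_e\lambda x_1\dots x_e.w$; for every other $p$, $t_i=p\gamma$. A chain is minimal if all strict subterms of all $t_i$ are $\to_{\mathcal R}$-terminating. It is formative if each reduction $t_i\to_{\mathcal R}^*s_{i+1}=\ell\gamma$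 with $\rho_{i+1}=\ell\Rrightarrow p\ (A)$ is $\ell$-formative. Here $s\to_{\mathcal R}^*\ell\gamma$ is $\ell$-formative if: $\ell$ is not a fully extended linear pattern (each abstraction's bound variable is an argument of all meta-variables below it, no meta-variable occurs twice); or $\ell=Z\langle x_1,\dots,x_k\rangle$ and $s=\ell\gamma$; or $s=a\,s_1\cdots s_n$, $\ell=a\,\ell_1\cdots\ell_n$ with $a$ a function symbol or variable and each $s_j\to_{\mathcal R}^*\ell_j\gamma$ is $\ell_j$-formative; or $s=\lambda x.s'$, $\ell=\lambda x.\ell'$ and $s'\to_{\mathcal R}^*\ell'\gamma$ is $\ell'$-formative; or $s=(\lambda x.u)\,v\,w_1\cdots w_n$ and $u[x:=v]\,w_1\cdots w_n\to_{\mathcal R}^*\ell\gamma$ is $\ell$-formative; or $\ell$ is not a meta-variable application and there are $\ell'\Rightarrow r'\in\mathcal R$, distinct fresh meta-variables $Z_1,\dots,Z_n$ of minimal arity $0$ and a substitution $\delta$ such that $s\to_{\mathcal R}^*(\ell'\,Z_1\cdots Z_n)\delta$ is $(\ell'\,Z_1\cdots Z_n)$-formative and $(r'\,Z_1\cdots Z_n)\delta\to_{\mathcal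 R}^*\ell\gamma$ is $\ell$-formative. **DP problems.** A DP problem is a tuple $(\mathcal P,\mathcal R,m,f)$ with $m\in\{\mathtt{minimal},\mathtt{arbitrary}\}\cup\{\mathtt{computable}_S\}$ and $f\in\{\mathtt{formative},\mathtt{all}\}$. It is finite if there is no $(\mathcal P,\mathcal R)$-chain that conforms to its flags (minimal, respectively $S$-computable; and formative if $f=\mathtt{formative}$), and infinite if it is not finite or $\mathcal R$ is non-terminating. A processor maps each DP problem to $\mathtt{NO}$ or to a set of DP problems. It is sound if every $M$ with $\mathit{Proc}(M)\ne\mathtt{NO}$ and all elements of $\mathit{Proc}(M)$ finite is finite; it is complete if every $M$ with $\mathit{Proc}(M)=\mathtt{NO}$ or with an infinite element in $\mathit{Proc}(M)$ is infinite. **Theorem (static subterm criterion processor).** For base-type meta-terms let $s\sqsupset t$ mean that $s\ne t$ and either (a) $s\unrhd_{\mathrm{acc}}t$, or (b) there is a meta-variable $Z$ with $s\unrhd_{\mathrm{acc}}Z\langle x_1,\dots,x_k\rangle$ for some variables $x_1,\dots,x_k$ and $t=Z\langle t_1,\dots,t_e\rangle\,s_1\cdots s_n$. A projection function $\nu$ for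 $\mathcal P$ maps function symbols to positions so that $\overline\nu(f\,s_1\cdots s_n)=s_{\nu(f)}$ is defined on both sides of every DP in $\mathcal P$. The processor that maps a DP problem $(\mathcal P,\mathcal R,\mathtt{computable}_S,f)$ to $\{(\mathcal P_2,\mathcal R,\mathtt{computable}_S,f)\}$ whenever * $\mathcal P=\mathcal P_1\uplus\mathcal P_2$ contains no collapsing DP, and * there is a projection function $\nu$ for $\mathcal P$ with $\overline\nu(\ell)\sqsupset\overline\nu(p)$ for all $\ell\Rrightarrow p\ (A)\in\mathcal P_1$ and $\overline\nu(\ell)=\overline\nu(p)$ for all $\ell\Rrightarrow p\ (A)\in\mathcal P_2$, and every other DP problem $M$ to $\{M\}$, is sound and complete. This holds for every choice of the decompositions $\mathcal P_1\uplus\mathcal P_2$ (where several satisfy the conditions) and of the RC-sets $C_S$. -/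

import Mathlib

universe u₁ u₂ u₃ u₄

namespace HODP

/-! ### Types, signatures -/

/-- Simple types over a set `S` of sorts. -/
inductive Ty (S : Type u₁) : Type u₁
  | base (ι : S) : Ty S
  | arrow (σ τ : Ty S) : Ty S

namespace Ty

variable {S : Type u₁}

/-- The argument types `σ₁, …, σₘ` of `σ₁ → ⋯ → σₘ → ι`. -/
def argTys : Ty S → List (Ty S)
  | base _ => []
  | arrow σ τ => σ :: τ.argTys

/-- The sort `ι` of `σ₁ → ⋯ → σₘ → ι`. -/
def target : Ty S → S
  | base ι => ι
  | arrow _ τ => τ.target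

/-- `σ₁ → ⋯ → σₙ → τ`. -/
def arrows (σs : List (Ty S)) (τ : Ty S) : Ty S := σs.foldr arrow τ

end Ty

/-- The data fixed once and for all: sorts with a quasi-ordering whose strict part is well-founded;
typed function symbols, typed variables, and meta-variables with type declarations
`[σ₁ × ⋯ × σₖ] → τ`; an arity function on function symbols; and the marking `f ↦ f♯`,
which is the identity outside a set `D` of symbols. -/
structure Framework where
  /-- sorts -/
  Srt : Type u₁
  /-- function symbols (including the marked ones) -/
  Fn : Type u₂
  /-- variables -/
  Vr : Type u₃
  /-- meta-variables -/
  Mv : Type u₄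
  fnTy : Fn → Ty Srt
  vrTy : Vr → Ty Srt
  mvArgs : Mv → List (Ty Srt)
  mvOut : Mv → Ty Srt
  fn_infinite : ∀ σ, {f | fnTy f = σ}.Infinite
  vr_infinite : ∀ σ, {x | vrTy x = σ}.Infinite
  mv_infinite : ∀ σs τ, {Z | mvArgs Z = σs ∧ mvOut Z = τ}.Infinite
  /-- the minimal arity of a function symbol -/
  ar : Fn → ℕ
  ar_le : ∀ f, ar f ≤ (fnTy f).argTys.length
  /-- the symbols that have a marked version -/
  D : Set Fn
  /-- `f ↦ f♯` -/
  mark : Fn → Fn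
  mark_of_notMem : ∀ f, f ∉ D → mark f = f
  mark_notMem : ∀ f, f ∈ D → mark f ∉ D
  mark_injOn : Set.InjOn mark D
  fnTy_mark : ∀ f, fnTy (mark f) = fnTy f
  ar_mark : ∀ f, ar (mark f) = ar f
  /-- the quasi-ordering `ι ≽ κ` on sorts -/
  ge : Srt → Srt → Prop
  ge_refl : ∀ ι, ge ι ι
  ge_trans : ∀ ι κ μ, ge ι κ → ge κ μ → ge ι μ
  /-- the strict part of `≽` is well-founded -/
  gt_wf : WellFounded fun κ ι : Srt => ge ι κ ∧ ¬ ge κ ι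

section

variable {F : Framework.{u₁, u₂, u₃, u₄}}

/-- The strict part `ι ≻ κ` of the sort ordering. -/
def Framework.gt (F : Framework.{u₁, u₂, u₃, u₄}) (ι κ : F.Srt) : Prop := F.ge ι κ ∧ ¬ F.ge κ ι

/-- The full type `σ₁ → ⋯ → σₖ → τ` of a meta-variable `Z : [σ₁ × ⋯ × σₖ] → τ`. -/
def Framework.mvTy (F : Framework.{u₁, u₂, u₃, u₄}) (Z : F.Mv) : Ty F.Srt :=
  Ty.arrows (F.mvArgs Z) (F.mvOut Z)

/-- The minimal arity `k` of a meta-variable `Z : [σ₁ × ⋯ × σₖ] → τ`. -/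
def Framework.mvAr (F : Framework.{u₁, u₂, u₃, u₄}) (Z : F.Mv) : ℕ := (F.mvArgs Z).length

/-! ### Meta-terms modulo α

Locally nameless representation: bound variables are de Bruijn indices, free variables are names. -/

/-- Raw meta-terms; `mapp Z e a` is the meta-variable application `Z⟨a₁, …, a_e⟩`. -/
inductive Tm (F : Framework.{u₁, u₂, u₃, u₄}) : Type (max u₁ u₂ u₃ u₄)
  | bvar (n : ℕ) : Tm F
  | fvar (x : F.Vr) : Tm F
  | fn (f : F.Fn) : Tm F
  | app (s t : Tm F) : Tm F
  | lam (σ : Ty F.Srt) (s : Tm F) : Tm F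
  | mapp (Z : F.Mv) (e : ℕ) (a : Fin e → Tm F) : Tm F

namespace Tm

/-- Typing; `Γ` lists the types of the dangling bound variables, innermost first. -/
inductive HasType : List (Ty F.Srt) → Tm F → Ty F.Srt → Prop
  | bvar {Γ n σ} : Γ[n]? = some σ → HasType Γ (bvar n) σ
  | fvar {Γ} (x) : HasType Γ (fvar x) (F.vrTy x)
  | fn {Γ} (f) : HasType Γ (fn f) (F.fnTy f)
  | app {Γ s t σ τ} : HasType Γ s (.arrow σ τ) → HasType Γ t σ → HasType Γ (app s t) τ
  | lam {Γ σ s τ} : HasType (σ :: Γ) s τ → HasType Γ (lam σ s) (.arrow σ τ)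
  | mapp {Γ Z e a τ} (σs : Fin e → Ty F.Srt) : F.mvAr Z ≤ e →
      F.mvTy Z = Ty.arrows (List.ofFn σs) τ → (∀ i, HasType Γ (a i) (σs i)) →
      HasType Γ (mapp Z e a) τ

/-- Free variables. -/
def FV : Tm F → Set F.Vr
  | bvar _ => ∅
  | fvar x => {x}
  | fn _ => ∅
  | app s t => s.FV ∪ t.FV
  | lam _ s => s.FV
  | mapp _ _ a => ⋃ i, (a i).FV

/-- Meta-variables occurring in a meta-term. -/
def FMV : Tm F → Set F.Mv
  | bvar _ => ∅
  | fvar _ => ∅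
  | fn _ => ∅
  | app s t => s.FMV ∪ t.FMV
  | lam _ s => s.FMV
  | mapp Z _ a => {Z} ∪ ⋃ i, (a i).FMV

/-- `s` is a meta-term of type `σ`. -/
def IsMetaTermOf (s : Tm F) (σ : Ty F.Srt) : Prop := HasType [] s σ

/-- `s` is a term (a meta-term without meta-variables) of type `σ`. -/
def IsTermOf (s : Tm F) (σ : Ty F.Srt) : Prop := HasType [] s σ ∧ s.FMV = ∅

/-- `s` is a term. -/
def IsTerm (s : Tm F) : Prop := ∃ σ, s.IsTermOf σ

/-- `s t₁ ⋯ tₙ`. -/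
def apps (s : Tm F) (ts : List (Tm F)) : Tm F := ts.foldl app s

/-- The head of `s`. -/
def head : Tm F → Tm F
  | app s _ => s.head
  | s => s

/-- The arguments `s₁, …, sₙ` of `head s s₁ ⋯ sₙ`. -/
def args : Tm F → List (Tm F)
  | app s t => s.args ++ [t]
  | _ => []

/-- Shift by `d` the dangling indices `≥ c`. -/
def lift (d : ℕ) : ℕ → Tm F → Tm F
  | c, bvar n => if n < c then bvar n else bvar (n + d)
  | _, fvar x => fvar x
  | _, fn f => fn f
  | c, app s t => app (lift d c s) (lift d c t)
  | c, lam σ s => lam σ (lift d (c + 1) s)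
  | c, mapp Z e a => mapp Z e fun i => lift d c (a i)

/-- Below `k` binders, replace the dangling indices `k, k + 1, …` by the entries of `env`. -/
def instAux (env : List (Tm F)) : ℕ → Tm F → Tm F
  | k, bvar n =>
      if n < k then bvar n
      else match env[n - k]? with
        | some t => lift k 0 t
        | none => bvar (n - env.length)
  | _, fvar x => fvar x
  | _, fn f => fn f
  | k, app s t => app (instAux env k s) (instAux env k t)
  | k, lam σ s => lam σ (instAux env (k + 1) s)
  | k, mapp Z e a => mapp Z e fun i => instAux env k (a i)

/-- `u[x := t]` for the body `u` of an abstraction `λx.u`. -/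
def inst (u t : Tm F) : Tm F := instAux [t] 0 u

/-- The body of `lam σ u` with the bound variable named `x` (to be used with `x` fresh for `u`). -/
def opn (u : Tm F) (x : F.Vr) : Tm F := inst u (fvar x)

open Classical in
/-- Turn the free variable `x` into the index of a binder placed `k` binders up. -/
noncomputable def close (x : F.Vr) : ℕ → Tm F → Tm F
  | k, bvar n => if n < k then bvar n else bvar (n + 1)
  | k, fvar y => if y = x then bvar k else fvar y
  | _, fn f => fn f
  | k, app s t => app (close x k s) (close x k t)
  | k, lam σ s => lam σ (close x (k + 1) s)
  | k, mapp Z e a => mapp Z e fun i => close x k (a i)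

/-- `λx.s`. -/
noncomputable def abs (x : F.Vr) (s : Tm F) : Tm F := lam (F.vrTy x) (close x 0 s)

/-- `λx₁ … xₙ.s`. -/
noncomputable def absList (xs : List F.Vr) (s : Tm F) : Tm F := xs.foldr abs s

/-! ### Substitution -/

/-- For `g = λx₁ … xᵢ.t` with at least as many abstractions as arguments (`i = e`), or with `t` not
an abstraction (`i < e`), `develop g [] [s₁, …, s_e]` is
`t[x₁ := s₁, …, xᵢ := sᵢ] s_{i+1} ⋯ s_e`; here `env` collects the values of the abstractions passed
so far, innermost first. -/
def develop : Tm F → List (Tm F) → List (Tm F) → Tm F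
  | lam _ u, env, s :: ss => develop u (s :: env) ss
  | t, env, ss => apps (instAux env 0 t) ss

end Tm

open Tm

/-- Functions from variables and meta-variables to meta-terms. -/
structure Subst (F : Framework.{u₁, u₂, u₃, u₄}) where
  v : F.Vr → Tm F
  m : F.Mv → Tm F

/-- `λy₁ … yₖ.Z⟨y₁, …, yₖ⟩` with `k` the minimal arity of `Z`. -/
def etaMeta (Z : F.Mv) : Tm F :=
  (F.mvArgs Z).foldr Tm.lam (Tm.mapp Z (F.mvAr Z) fun i => Tm.bvar (F.mvAr Z - 1 - i))

namespace Subst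

/-- Type preservation, where `γ(Z)` must have the form `λy₁ … yₖ.u`. -/
def IsMetaSubst (γ : Subst F) : Prop :=
  (∀ x, (γ.v x).IsMetaTermOf (F.vrTy x)) ∧
  ∀ Z, (γ.m Z).IsMetaTermOf (F.mvTy Z) ∧ ∃ u, γ.m Z = (F.mvArgs Z).foldr Tm.lam u

/-- The variables in the domain. -/
def domV (γ : Subst F) : Set F.Vr := {x | γ.v x ≠ Tm.fvar x}

/-- The meta-variables in the domain. -/
def domM (γ : Subst F) : Set F.Mv := {Z | γ.m Z ≠ etaMeta Z}

/-- A substitution: everything in the domain is mapped to a term. -/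
def IsSubst (γ : Subst F) : Prop :=
  γ.IsMetaSubst ∧ (∀ x ∈ γ.domV, (γ.v x).FMV = ∅) ∧ ∀ Z ∈ γ.domM, (γ.m Z).FMV = ∅

/-- `γ(Z) ≈ₑ λx₁ … xₑ.t`, where `xs = [x₁, …, xₑ]`. -/
def Approx (γ : Subst F) (Z : F.Mv) (xs : List F.Vr) (t : Tm F) : Prop :=
  xs.Nodup ∧ (∀ x ∈ xs, x ∉ (γ.m Z).FV) ∧ xs.map F.vrTy <+: (F.mvTy Z).argTys ∧
  F.mvAr Z ≤ xs.length ∧ t = develop (γ.m Z) [] (xs.map Tm.fvar)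

/-- `γ` respects a set of meta-variable conditions: `(Z, i)` says that `Z` regards its argument at
position `i`, positions being counted from `0`. -/
def Respects (γ : Subst F) (A : Set (F.Mv × ℕ)) : Prop :=
  ∀ Z i, (Z, i) ∈ A → ∃ xs t x, γ.Approx Z xs t ∧ xs[i]? = some x ∧ x ∈ t.FV

end Subst

/-- The result `sγ` of applying a meta-substitution. -/
def Tm.subst (γ : Subst F) : Tm F → Tm F
  | bvar n => bvar n
  | fvar x => γ.v x
  | fn f => fn f
  | app s t => app (s.subst γ) (t.subst γ)
  | lam σ s => lam σ (s.subst γ)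
  | mapp Z _ a => develop (γ.m Z) [] (List.ofFn fun i => (a i).subst γ)

open Classical in
/-- The function `[x₁ := t₁, …, xₙ := tₙ]` on variables. -/
noncomputable def bindVars : List F.Vr → List (Tm F) → F.Vr → Tm F
  | x :: xs, t :: ts, y => if y = x then t else bindVars xs ts y
  | _, _, y => Tm.fvar y

/-- The substitution `[x₁ := t₁, …, xₙ := tₙ]`. -/
noncomputable def substVars (xs : List F.Vr) (ts : List (Tm F)) : Subst F :=
  ⟨bindVars xs ts, etaMeta⟩

/-! ### Patterns, rules, rewriting -/

namespace Tm

/-- A function symbol or a variable. -/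
def IsSymbol (a : Tm F) : Prop := (∃ f, a = fn f) ∨ ∃ x, a = fvar x

inductive IsPattern : Tm F → Prop
  | mapp (Z : F.Mv) (x : Fin (F.mvAr Z) → F.Vr) : Function.Injective x →
      IsPattern (mapp Z (F.mvAr Z) fun i => fvar (x i))
  | lam {σ u} (x : F.Vr) : F.vrTy x = σ → x ∉ u.FV → IsPattern (opn u x) → IsPattern (lam σ u)
  | app {a ls} : a.IsSymbol → (∀ l ∈ ls, IsPattern l) → IsPattern (apps a ls)

/-- The bound variable with index `n` is an argument to all meta-variable occurrences. -/
def BoundInMetas : ℕ → Tm F → Prop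
  | n, app s t => BoundInMetas n s ∧ BoundInMetas n t
  | n, lam _ s => BoundInMetas (n + 1) s
  | n, mapp _ _ a => ∃ i, a i = bvar n
  | _, _ => True

/-- Fully extended (for patterns). -/
def FullyExtended : Tm F → Prop
  | app s t => s.FullyExtended ∧ t.FullyExtended
  | lam _ s => BoundInMetas 0 s ∧ s.FullyExtended
  | _ => True

/-- Each meta-variable occurs at most once. -/
def Linear : Tm F → Prop
  | app s t => s.Linear ∧ t.Linear ∧ Disjoint s.FMV t.FMV
  | lam _ s => s.Linear
  | mapp Z _ a => (∀ i, (a i).Linear ∧ Z ∉ (a i).FMV) ∧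
      ∀ i j, i ≠ j → Disjoint (a i).FMV (a j).FMV
  | _ => True

/-- The subterm relation `s ⊵ t`. -/
inductive Subterm : Tm F → Tm F → Prop
  | refl (s) : Subterm s s
  | lam {σ u t} (x : F.Vr) : F.vrTy x = σ → x ∉ u.FV → Subterm (opn u x) t → Subterm (lam σ u) t
  | left {s₁ s₂ t} : Subterm s₁ t → Subterm (app s₁ s₂) t
  | right {s₁ s₂ t} : Subterm s₂ t → Subterm (app s₁ s₂) t

open Classical in
/-- `s♯`: the head `f` of `f s₁ ⋯ sₖ` is marked if `k` is the minimal arity of `f`. -/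
noncomputable def marked (s : Tm F) : Tm F :=
  if ∃ f, s.head = fn f ∧ s.args.length = F.ar f then
    match s.head with
    | fn f => apps (fn (F.mark f)) s.args
    | _ => s
  else s

end Tm

/-- Rewrite rules `ℓ ⇒ r`. -/
structure Rule (F : Framework.{u₁, u₂, u₃, u₄}) where
  lhs : Tm F
  rhs : Tm F
  same_type : ∃ σ, lhs.IsMetaTermOf σ ∧ rhs.IsMetaTermOf σ
  lhs_closed : lhs.FV = ∅
  rhs_closed : rhs.FV = ∅
  lhs_pattern : lhs.IsPattern
  lhs_form : ∃ f ls, lhs = apps (fn f) ls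
  fmv_subset : rhs.FMV ⊆ lhs.FMV

/-- The rewrite relation of a set of rules. It is only ever used on terms. -/
inductive Step (R : Set (Rule F)) : Tm F → Tm F → Prop
  | rule {ρ : Rule F} {δ : Subst F} : ρ ∈ R → δ.IsSubst → δ.domV = ∅ → δ.domM = ρ.lhs.FMV →
      Step R (ρ.lhs.subst δ) (ρ.rhs.subst δ)
  | beta (σ s t) : Step R (app (lam σ s) t) (inst s t)
  | appLeft {s s'} (t) : Step R s s' → Step R (app s t) (app s' t)
  | appRight (s) {t t'} : Step R t t' → Step R (app s t) (app s t')
  | lam {σ u u'} (x : F.Vr) : F.vrTy x = σ → x ∉ u.FV → x ∉ u'.FV →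
      Step R (opn u x) (opn u' x) → Step R (lam σ u) (lam σ u')

/-- The reflexive-transitive closure of the rewrite relation. -/
def Steps (R : Set (Rule F)) : Tm F → Tm F → Prop := Relation.ReflTransGen (Step R)

/-- No infinite sequence of steps starts in `s`. -/
def TerminatingAt (r : Tm F → Tm F → Prop) (s : Tm F) : Prop :=
  ¬ ∃ q : ℕ → Tm F, q 0 = s ∧ ∀ n, r (q n) (q (n + 1))

/-- A set of rules is terminating if all terms are. -/
def RulesTerminating (R : Set (Rule F)) : Prop := ∀ s : Tm F, s.IsTerm → TerminatingAt (Step R) s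

/-! ### Computability -/

/-- A term of the form `x s₁ ⋯ sₙ` or `(λx.u) s₀ ⋯ sₙ`. -/
def Neutral (s : Tm F) : Prop :=
  (∃ x ss, s = apps (fvar x) ss) ∨ ∃ σ u s₀ ss, s = apps (app (lam σ u) s₀) ss

/-- `I` is an RC-set for the rewrite relation of `R`. -/
structure IsRCSet (R : Set (Rule F)) (I : Set (Tm F)) : Prop where
  base : ∀ s ∈ I, ∃ ι, s.IsTermOf (.base ι)
  terminating : ∀ s ∈ I, TerminatingAt (Step R) s
  closed : ∀ s ∈ I, ∀ t, Step R s t → t ∈ I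
  neutral : ∀ s ι, s.IsTermOf (.base ι) → Neutral s → (∀ t, Step R s t → t ∈ I) → s ∈ I

/-- `s` is an `I`-computable term of the given type. -/
def CompAt (I : Set (Tm F)) : Ty F.Srt → Tm F → Prop
  | .base ι, s => s.IsTermOf (.base ι) ∧ s ∈ I
  | .arrow σ τ, s => s.IsTermOf (.arrow σ τ) ∧ ∀ t, CompAt I σ t → CompAt I τ (app s t)

/-- `s` is `I`-computable. -/
def Comp (I : Set (Tm F)) (s : Tm F) : Prop := ∃ σ, CompAt I σ s

mutual
/-- `ι ≽₊ σ`. -/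
def GePos (ι : F.Srt) : Ty F.Srt → Prop
  | .base κ => F.ge ι κ
  | .arrow σ τ => GtNeg ι σ ∧ GePos ι τ
/-- `ι ≻₋ σ`. -/
def GtNeg (ι : F.Srt) : Ty F.Srt → Prop
  | .base κ => F.gt ι κ
  | .arrow σ τ => GePos ι σ ∧ GtNeg ι τ
end

/-- The accessible argument positions (from `0`) of a function symbol. -/
def AccFn (f : F.Fn) : Set ℕ :=
  {i | ∃ σ, (F.fnTy f).argTys[i]? = some σ ∧ GePos (F.fnTy f).target σ}

/-- The accessible argument positions (from `0`) of a variable. -/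
def AccVr (x : F.Vr) : Set ℕ :=
  {i | ∃ σ, (F.vrTy x).argTys[i]? = some σ ∧ F.ge (F.vrTy x).target σ.target}

/-- The accessible-subterm relation `s ⊵_acc t`, on meta-terms. -/
inductive AccSub : Tm F → Tm F → Prop
  | refl (s) : AccSub s s
  | lam {σ u t} (x : F.Vr) : F.vrTy x = σ → x ∉ u.FV → AccSub (opn u x) t → AccSub (lam σ u) t
  | fn {f ss i s t} : i ∈ AccFn f → ss[i]? = some s → AccSub s t → AccSub (apps (fn f) ss) t
  | vr {x ss i s t} : i ∈ AccVr x → ss[i]? = some s → AccSub s t → AccSub (apps (fvar x) ss) t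

/-- `f s₁ ⋯ sₘ ⇛_I sᵢ t₁ ⋯ tₙ` with `i` accessible, all `tⱼ` `I`-computable, and both sides terms of
base type. -/
def AccReduce (I : Set (Tm F)) (s s' : Tm F) : Prop :=
  (∃ ι, s.IsTermOf (.base ι)) ∧ (∃ κ, s'.IsTermOf (.base κ)) ∧
  ∃ f ss i si ts, s = apps (fn f) ss ∧ i ∈ AccFn f ∧ ss[i]? = some si ∧ (∀ t ∈ ts, Comp I t) ∧
    s' = apps si ts

/-- The RC-sets `C_S` by which `S`-computability of chains is measured: RC-sets `C` for `→_S` such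
that `C` consists of the base-type terms `s` that are terminating under `→_S ∪ ⇛_C` and such that
all accessible arguments of each `→_S`-reduct `f s₁ ⋯ sₘ` of `s` are `C`-computable. -/
structure CompSet (S : Set (Rule F)) where
  C : Set (Tm F)
  isRC : IsRCSet S C
  mem_iff : ∀ s, s ∈ C ↔ (∃ ι, s.IsTermOf (.base ι)) ∧
    TerminatingAt (fun a b => Step S a b ∨ AccReduce C a b) s ∧
    ∀ f ss, Steps S s (apps (fn f) ss) → ∀ i ∈ AccFn f, ∀ si, ss[i]? = some si → Comp C si

/-! ### Dependency pairs and chains -/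

/-- Dependency pairs `ℓ ⇛ p (A)`. -/
structure DP (F : Framework.{u₁, u₂, u₃, u₄}) where
  lhs : Tm F
  rhs : Tm F
  cond : Set (F.Mv × ℕ)
  lhs_typed : ∃ σ, lhs.IsMetaTermOf σ
  rhs_typed : ∃ σ, rhs.IsMetaTermOf σ
  lhs_pattern : lhs.IsPattern
  lhs_closed : lhs.FV = ∅
  lhs_form : ∃ f ls, lhs = apps (fn f) ls ∧ F.ar f ≤ ls.length

/-- The right-hand side has the form `Z⟨s₁, …, s_e⟩ t₁ ⋯ tⱼ`. -/
def DP.Collapsing (d : DP F) : Prop := ∃ Z e a ts, d.rhs = apps (mapp Z e a) ts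

/-- `s ⊵_A t`: `t` is a β-reduced-sub-meta-term of `s` under the meta-variable conditions `A`. -/
inductive BSub (A : Set (F.Mv × ℕ)) : Tm F → Tm F → Prop
  | pre (t ss) : BSub A (apps t ss) t
  | lam {σ u t} (x : F.Vr) : F.vrTy x = σ → x ∉ u.FV → BSub A (opn u x) t → BSub A (lam σ u) t
  | beta {σ u s₀ ss t} : BSub A (apps (inst u s₀) ss) t → BSub A (apps (app (lam σ u) s₀) ss) t
  | arg {a ss s t} : (∀ b c, a ≠ app b c) → s ∈ ss → BSub A s t → BSub A (apps a ss) t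
  | mapp {Z e a ss t} (i : Fin e) : (Z, (i : ℕ)) ∈ A → BSub A (a i) t →
      BSub A (apps (mapp Z e a) ss) t

/-- A sequence of triples `(ρᵢ, sᵢ, tᵢ)`; `ρᵢ = none` stands for a `beta` step. -/
structure ChainData (F : Framework.{u₁, u₂, u₃, u₄}) where
  ρ : ℕ → Option (DP F)
  s : ℕ → Tm F
  t : ℕ → Tm F

/-- The `beta` case of a dependency chain. The last condition says that the bound variables of `u`
that are freed when passing to the subterm `q` are not captured by `v`. -/
def BetaStep (s t : Tm F) : Prop :=
  ∃ σ u v ws, s = apps (app (lam σ u) v) ws ∧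
    ((ws ≠ [] ∧ t = apps (inst u v) ws) ∨
     (ws = [] ∧ ∃ x q, F.vrTy x = σ ∧ x ∉ u.FV ∧ Subterm (opn u x) q ∧ x ∈ q.FV ∧ q ≠ fvar x ∧
        t = q.marked.subst (substVars [x] [v]) ∧
        ∀ y ∈ q.FV, y ∉ (opn u x).FV → y ∉ v.FV))

/-- The substitution `γ` turns the dependency pair `ℓ ⇛ p (A)` into the step `(s, t)` of a chain.
The variables of `p` are mapped to distinct variables that occur neither in `p` nor in the values of
the meta-variables. In the case of a meta-variable application, the bound variables that are freed
when passing to the subterm `v` are not captured. -/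
structure DPStep (d : DP F) (s t : Tm F) (γ : Subst F) : Prop where
  isSubst : γ.IsSubst
  domM : γ.domM = d.lhs.FMV ∪ d.rhs.FMV
  domV : γ.domV = d.rhs.FV
  fresh : ∀ x ∈ d.rhs.FV, ∃ y, γ.v x = fvar y ∧ y ∉ d.rhs.FV ∧
    ∀ Z ∈ d.lhs.FMV ∪ d.rhs.FMV, y ∉ (γ.m Z).FV
  fresh_inj : Set.InjOn γ.v d.rhs.FV
  source : s = d.lhs.subst γ
  target_instance : (∀ Z e a, d.rhs ≠ mapp Z e a) → t = d.rhs.subst γ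
  target_meta : ∀ Z e a, d.rhs = mapp Z e a →
    ∃ xs w v, γ.Approx Z xs w ∧ xs.length = e ∧ Subterm w v ∧ (∀ y, v ≠ fvar y) ∧
      (∃ x ∈ xs, x ∈ v.FV) ∧
      t = v.marked.subst (substVars xs (List.ofFn fun i => (a i).subst γ)) ∧
      ∀ y ∈ v.FV, y ∉ w.FV → ∀ i, y ∉ ((a i).subst γ).FV
  respects : γ.Respects d.cond

/-- `c` is an (infinite) `(P, R)`-dependency chain. -/
structure IsChain (P : Set (DP F)) (R : Set (Rule F)) (c : ChainData F) : Prop where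
  mem : ∀ i d, c.ρ i = some d → d ∈ P
  s_term : ∀ i, (c.s i).IsTerm
  t_term : ∀ i, (c.t i).IsTerm
  beta : ∀ i, c.ρ i = none → BetaStep (c.s i) (c.t i)
  dp : ∀ i d, c.ρ i = some d → ∃ γ, DPStep d (c.s i) (c.t i) γ
  reduce : ∀ i, c.t i = c.s (i + 1) ∨
    ∃ f us ws, c.t i = apps (fn f) us ∧ c.s (i + 1) = apps (fn f) ws ∧
      List.Forall₂ (Steps R) us ws

/-- All strict subterms of all `tᵢ` are terminating. -/
def IsMinimalChain (R : Set (Rule F)) (c : ChainData F) : Prop :=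
  ∀ i q, Subterm (c.t i) q → q ≠ c.t i → TerminatingAt (Step R) q

/-- `FormativeRed R ℓ γ s`: there is an `ℓ`-formative reduction from `s` to `ℓγ`. -/
inductive FormativeRed (R : Set (Rule F)) : Tm F → Subst F → Tm F → Prop
  | other {ℓ γ s} : ¬ (ℓ.IsPattern ∧ ℓ.FullyExtended ∧ ℓ.Linear) → Steps R s (ℓ.subst γ) →
      FormativeRed R ℓ γ s
  | mapp {γ} (Z k) (x : Fin k → F.Vr) :
      FormativeRed R (mapp Z k fun i => fvar (x i)) γ ((mapp Z k fun i => fvar (x i)).subst γ)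
  | app {γ a ls ss} : a.IsSymbol → a.subst γ = a → ls.length = ss.length →
      (∀ q ∈ ls.zip ss, FormativeRed R q.1 γ q.2) → FormativeRed R (apps a ls) γ (apps a ss)
  | lam {γ σ ℓ s} (x : F.Vr) : F.vrTy x = σ → x ∉ ℓ.FV → x ∉ s.FV → γ.v x = fvar x →
      (∀ y ∈ ℓ.FV, x ∉ (γ.v y).FV) → (∀ Z ∈ ℓ.FMV, x ∉ (γ.m Z).FV) →
      FormativeRed R (opn ℓ x) γ (opn s x) → FormativeRed R (lam σ ℓ) γ (lam σ s)
  | beta {ℓ γ σ u v ws} : FormativeRed R ℓ γ (apps (inst u v) ws) →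
      FormativeRed R ℓ γ (apps (app (lam σ u) v) ws)
  | rule {ℓ γ s} (δ : Subst F) (ρ : Rule F) (Zs : List F.Mv) : (∀ Z e a, ℓ ≠ mapp Z e a) → ρ ∈ R →
      Zs.Nodup → (∀ Z ∈ Zs, F.mvArgs Z = [] ∧ Z ∉ ρ.lhs.FMV) →
      δ.IsSubst → δ.domV = ∅ → δ.domM = ρ.lhs.FMV ∪ {Z | Z ∈ Zs} →
      FormativeRed R (apps ρ.lhs (Zs.map fun Z => mapp Z 0 Fin.elim0)) δ s →
      FormativeRed R ℓ γ ((apps ρ.rhs (Zs.map fun Z => mapp Z 0 Fin.elim0)).subst δ) →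
      FormativeRed R ℓ γ s

/-- A formative chain: each reduction from `tᵢ` to `s_{i+1} = ℓγ` is `ℓ`-formative. -/
def IsFormativeChain (R : Set (Rule F)) (c : ChainData F) : Prop :=
  ∀ i d, c.ρ (i + 1) = some d →
    ∃ γ, DPStep d (c.s (i + 1)) (c.t (i + 1)) γ ∧ FormativeRed R d.lhs γ (c.t i)

/-- An `S`-computable chain, with respect to the RC-set `C = C_S`. -/
def IsComputableChain (R S : Set (Rule F)) (C : Set (Tm F)) (c : ChainData F) : Prop :=
  (∀ s t : Tm F, s.IsTerm → Step R s t → Step S s t) ∧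
  ∀ i, ∃ d γ, c.ρ i = some d ∧ DPStep d (c.s i) (c.t i) γ ∧ c.t i = d.rhs.subst γ ∧
    ∀ v B, BSub B d.rhs v → γ.Respects B →
      ∀ xs : List F.Vr, xs.Nodup → {x | x ∈ xs} = v.FV → Comp C ((absList xs v).subst γ)

/-! ### DP problems and processors -/

/-- The flag `m`. The flag `computable_S` records which RC-set `C_S` is used. -/
inductive MFlag (F : Framework.{u₁, u₂, u₃, u₄})
  | minimal
  | arbitrary
  | computable (S : Set (Rule F)) (C : CompSet S)

/-- The flag `f`. -/
inductive FFlag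
  | formative
  | all

structure DPProblem (F : Framework.{u₁, u₂, u₃, u₄}) where
  P : Set (DP F)
  R : Set (Rule F)
  m : MFlag F
  f : FFlag

/-- The chains admitted by the flag `m`. -/
def MFlag.Admits (R : Set (Rule F)) (c : ChainData F) : MFlag F → Prop
  | .minimal => IsMinimalChain R c
  | .arbitrary => True
  | .computable S C => IsComputableChain R S C.C c

/-- No infinite chain conforms to the flags. -/
def DPProblem.IsFinite (M : DPProblem F) : Prop :=
  ¬ ∃ c, IsChain M.P M.R c ∧ M.m.Admits M.R c ∧ (M.f = .formative → IsFormativeChain M.R c)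

def DPProblem.IsInfinite (M : DPProblem F) : Prop := ¬ M.IsFinite ∨ ¬ RulesTerminating M.R

/-- Processors; `none` stands for the answer `NO`. -/
abbrev Processor (F : Framework.{u₁, u₂, u₃, u₄}) := DPProblem F → Option (Set (DPProblem F))

def Processor.Sound (Proc : Processor F) : Prop :=
  ∀ M, (∃ Q, Proc M = some Q ∧ ∀ M' ∈ Q, M'.IsFinite) → M.IsFinite

def Processor.Complete (Proc : Processor F) : Prop :=
  ∀ M, (Proc M = none ∨ ∃ Q, Proc M = some Q ∧ ∃ M' ∈ Q, M'.IsInfinite) → M.IsInfinite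

/-! ### The static subterm criterion -/

/-- `ν̄(f s₁ ⋯ sₙ) = s_{ν(f)}` (positions from `0`), if defined. -/
def proj (ν : F.Fn → ℕ) (s : Tm F) : Option (Tm F) :=
  match s.head with
  | fn f => s.args[ν f]?
  | _ => none

/-- `ν` is a projection function for `P`. -/
def IsProjection (ν : F.Fn → ℕ) (P : Set (DP F)) : Prop :=
  ∀ d ∈ P, (∃ u, proj ν d.lhs = some u) ∧ ∃ v, proj ν d.rhs = some v

/-- The relation `s ⊐ t` on base-type meta-terms. -/
def StaticGt (s t : Tm F) : Prop :=
  (∃ ι, s.IsMetaTermOf (.base ι)) ∧ (∃ κ, t.IsMetaTermOf (.base κ)) ∧ s ≠ t ∧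
  (AccSub s t ∨
    ∃ (Z : F.Mv) (k : ℕ) (x : Fin k → F.Vr) (e : ℕ) (a : Fin e → Tm F) (ss : List (Tm F)),
      AccSub s (mapp Z k fun i => fvar (x i)) ∧ t = apps (mapp Z e a) ss)

/-- `M = (P, R, computable_S, f)` and `P = P₁ ⊎ P₂` with the conditions of the static subterm
criterion. -/
def StaticSubtermApplies (M : DPProblem F) (P₂ : Set (DP F)) : Prop :=
  (∃ S C, M.m = .computable S C) ∧
  ∃ P₁, M.P = P₁ ∪ P₂ ∧ Disjoint P₁ P₂ ∧ (∀ d ∈ M.P, ¬ d.Collapsing) ∧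
    ∃ ν, IsProjection ν M.P ∧
      (∀ d ∈ P₁, ∃ u v, proj ν d.lhs = some u ∧ proj ν d.rhs = some v ∧ StaticGt u v) ∧
      ∀ d ∈ P₂, proj ν d.lhs = proj ν d.rhs

/-- A static subterm criterion processor: it maps `(P, R, computable_S, f)` to
`{(P₂, R, computable_S, f)}` for some `P₂` as in the criterion, and `M` to `{M}` if there is none. -/
def IsStaticSubtermProcessor (Proc : Processor F) : Prop :=
  ∀ M, (∃ P₂, StaticSubtermApplies M P₂ ∧ Proc M = some {{ M with P := P₂ }}) ∨
    ((¬ ∃ P₂, StaticSubtermApplies M P₂) ∧ Proc M = some {M})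

end

end HODP

-- Project every step of a computable chain with `ν`. Between two steps the projected term moves by
-- `→_R*`, hence by `→_S*`, and pairs in `P₂` leave it unchanged. At a pair in `P₁` the projected
-- right-hand side lies in `C`, because the chain is computable and the term has base type. So it
-- suffices that a pair in `P₁` makes a well-founded quantity decrease. That quantity is
-- lexicographic: first the sort of the projected term, then the term itself under `→_S ∪ ⇛_C`,
-- which terminates on `C`.
--
-- The decrease (`StaticGt.decrease`) rests on a dichotomy for `u ⊵_acc t` with `u` closed of base
-- type `ι` (`AccSub.fnAccSub_or_gt`). If the path enters an argument of a variable, that variable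
-- was bound on the way down. Positivity forces its output sort strictly below `ι`, and later steps
-- never raise the sort, so the sort drops. Otherwise the path uses only abstractions and arguments
-- of function symbols. It can then be imitated on instances: an abstraction is entered by a β-step
-- on a computable argument, a function symbol by a `⇛_C` step, and every step carries along
-- computable arguments that keep the whole term at base type (`FnAccSub.reduces`).
--
-- In case (b), `u` reaches only `Z⟨x₁,…,xₖ⟩`, while the target is `Z⟨a₁,…,a_e⟩ ss`. Since `u` is
-- closed, the `xⱼ` may be instantiated at will, so they are sent to the instances of the first `k`
-- arguments; the others are supplied by application and consumed by β (`Tm.steps_develop`). An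
-- instance is known to be computable only if `γ(Z)` uses that argument. Unused arguments are
-- replaced by variables, which changes nothing in the result (`exists_comp_args`).
--
-- Hence pairs of `P₁` occur finitely often and a tail of the chain is a `P₂`-chain with the same
-- flags, which gives soundness. Completeness holds because the processor only removes pairs.

namespace HODP

open Tm

variable {F : Framework.{u₁, u₂, u₃, u₄}}

/-! ### Iterated application -/

namespace Tm

@[simp] theorem apps_nil (s : Tm F) : apps s [] = s := rfl

@[simp] theorem apps_cons (s t : Tm F) (ts : List (Tm F)) :
    apps s (t :: ts) = apps (app s t) ts := rfl

theorem apps_append (s : Tm F) (ts us : List (Tm F)) : apps s (ts ++ us) = apps (apps s ts) us := by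
  simp [apps]

theorem head_apps (s : Tm F) (ts : List (Tm F)) : (apps s ts).head = s.head := by
  induction ts generalizing s with
  | nil => rfl
  | cons t ts ih => rw [apps_cons, ih]; rfl

theorem args_apps (s : Tm F) (ts : List (Tm F)) : (apps s ts).args = s.args ++ ts := by
  induction ts generalizing s with
  | nil => simp
  | cons t ts ih => rw [apps_cons, ih]; simp [args]

theorem apps_head_args (s : Tm F) : apps s.head s.args = s := by
  induction s with
  | app s t ihs _ => simp only [head, args, apps_append, ihs]; rfl
  | _ => rfl

theorem FV_apps (s : Tm F) (ts : List (Tm F)) (x : F.Vr) :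
    x ∈ (apps s ts).FV ↔ x ∈ s.FV ∨ ∃ t ∈ ts, x ∈ t.FV := by
  induction ts generalizing s with
  | nil => simp
  | cons t ts ih => rw [apps_cons, ih]; simp [FV, or_assoc]

theorem FMV_apps (s : Tm F) (ts : List (Tm F)) (Z : F.Mv) :
    Z ∈ (apps s ts).FMV ↔ Z ∈ s.FMV ∨ ∃ t ∈ ts, Z ∈ t.FMV := by
  induction ts generalizing s with
  | nil => simp
  | cons t ts ih => rw [apps_cons, ih]; simp [FMV, or_assoc]

theorem subst_apps (γ : Subst F) (s : Tm F) (ts : List (Tm F)) :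
    (apps s ts).subst γ = apps (s.subst γ) (ts.map (Tm.subst γ)) := by
  induction ts generalizing s with
  | nil => rfl
  | cons t ts ih => rw [apps_cons, ih]; rfl

theorem instAux_apps (E : List (Tm F)) (k : ℕ) (s : Tm F) (ts : List (Tm F)) :
    instAux E k (apps s ts) = apps (instAux E k s) (ts.map (instAux E k)) := by
  induction ts generalizing s with
  | nil => rfl
  | cons t ts ih => rw [apps_cons, ih]; simp [instAux]

theorem FV_finite (s : Tm F) : s.FV.Finite := by
  induction s with
  | bvar n => exact Set.finite_empty
  | fvar x => exact Set.finite_singleton x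
  | fn f => exact Set.finite_empty
  | app s t ihs iht => exact ihs.union iht
  | lam σ s ih => exact ih
  | mapp Z e a ih => exact Set.finite_iUnion ih

/-! ### Dangling indices -/

/-- All dangling indices of `s` are below `k`. -/
def LC : ℕ → Tm F → Prop
  | k, bvar n => n < k
  | _, fvar _ => True
  | _, fn _ => True
  | k, app s t => LC k s ∧ LC k t
  | k, lam _ s => LC (k + 1) s
  | k, mapp _ _ a => ∀ i, LC k (a i)

theorem LC.mono {s : Tm F} {k l : ℕ} (h : LC k s) (hkl : k ≤ l) : LC l s := by
  induction s generalizing k l with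
  | bvar n => exact lt_of_lt_of_le (show n < k from h) hkl
  | fvar x => trivial
  | fn f => trivial
  | app s t ihs iht => exact ⟨ihs h.1 hkl, iht h.2 hkl⟩
  | lam σ s ih => exact ih (k := k + 1) h (by omega)
  | mapp Z e a ih => exact fun i => ih i (h i) hkl

theorem lift_of_LC {s : Tm F} {c : ℕ} (d : ℕ) (h : LC c s) : lift d c s = s := by
  induction s generalizing c with
  | bvar n => exact if_pos h
  | fvar x => rfl
  | fn f => rfl
  | app s t ihs iht => simp only [lift]; rw [ihs h.1, iht h.2]
  | lam σ s ih => simp only [lift]; rw [ih h]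
  | mapp Z e a ih => simp only [lift]; congr 1; funext i; exact ih i (h i)

theorem instAux_of_LC {s : Tm F} {k : ℕ} (E : List (Tm F)) (h : LC k s) : instAux E k s = s := by
  induction s generalizing k with
  | bvar n => exact if_pos h
  | fvar x => rfl
  | fn f => rfl
  | app s t ihs iht => simp only [instAux]; rw [ihs h.1, iht h.2]
  | lam σ s ih => simp only [instAux]; rw [ih h]
  | mapp Z e a ih => simp only [instAux]; congr 1; funext i; exact ih i (h i)

theorem instAux_lift {E : List (Tm F)} (hE : ∀ t ∈ E, LC 0 t) (j : ℕ) (s : Tm F) {c k : ℕ}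
    (hc : c ≤ k) : instAux E (j + k) (lift j c s) = lift j c (instAux E k s) := by
  induction s generalizing c k with
  | bvar n =>
    simp only [lift, instAux]
    by_cases h1 : n < c
    · rw [if_pos h1, if_pos (show n < k by omega)]
      simp only [instAux, lift]
      rw [if_pos (show n < j + k by omega), if_pos h1]
    · rw [if_neg h1]
      simp only [instAux]
      by_cases h2 : n < k
      · rw [if_pos h2, if_pos (show n + j < j + k by omega)]
        simp only [lift]; rw [if_neg h1]
      · rw [if_neg h2, if_neg (show ¬ n + j < j + k by omega),
          show n + j - (j + k) = n - k by omega]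
        cases h3 : E[n - k]? with
        | some t =>
          have ht := hE t (List.mem_of_getElem? h3)
          simp only
          rw [lift_of_LC _ ht, lift_of_LC _ ht, lift_of_LC _ (ht.mono (Nat.zero_le c))]
        | none =>
          have := List.getElem?_eq_none_iff.1 h3
          simp only [lift]
          rw [if_neg (by omega)]
          congr 1
          omega
  | fvar x => rfl
  | fn f => rfl
  | app s t ihs iht => simp only [lift, instAux]; rw [ihs hc, iht hc]
  | lam σ s ih =>
    simp only [lift, instAux]
    rw [← ih (Nat.succ_le_succ hc)]; rfl
  | mapp Z e a ih => simp only [lift, instAux]; congr 1; funext i; exact ih i hc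

/-- The bound on `t` means that `env` already resolves every index from `j` on, so the outer
instantiation can act only inside the entries of `env`. -/
theorem instAux_instAux {E : List (Tm F)} (hE : ∀ t ∈ E, LC 0 t) (k : ℕ) {env : List (Tm F)}
    (t : Tm F) (j : ℕ) (ht : LC (j + env.length) t) :
    instAux E (j + k) (instAux env j t) = instAux (env.map (instAux E k)) j t := by
  induction t generalizing j with
  | bvar n =>
    have hn : n < j + env.length := ht
    by_cases h1 : n < j
    · simp only [instAux, if_pos h1]; rw [if_pos (by omega)]
    · have h2 : n - j < env.length := by omega
      simp only [instAux, if_neg h1, List.getElem?_map, List.getElem?_eq_getElem h2,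
        Option.map_some]
      exact instAux_lift hE j _ (Nat.zero_le k)
  | fvar x => rfl
  | fn f => rfl
  | app s t ihs iht => simp only [instAux]; rw [ihs j ht.1, iht j ht.2]
  | lam σ s ih =>
    simp only [instAux]
    rw [← ih (j + 1) (by rw [Nat.add_right_comm]; exact ht), Nat.add_right_comm]
  | mapp Z e a ih => simp only [instAux]; congr 1; funext i; exact ih i j (ht i)

/-- Contracting a β-redex whose body was instantiated under its binder amounts to pushing one more
value onto the environment. This links β-steps with `develop`. -/
theorem inst_instAux_succ (b : Tm F) {env : List (Tm F)} (hE : ∀ t ∈ env, LC 0 t)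
    (u : Tm F) (j : ℕ) : instAux [b] j (instAux env (j + 1) u) = instAux (b :: env) j u := by
  induction u generalizing j with
  | bvar n =>
    rcases lt_trichotomy n j with h | h | h
    · simp [instAux, h, Nat.lt_succ_of_lt h]
    · subst h; simp [instAux]
    · have h1 : ¬ n < j := by omega
      have h2 : ¬ n < j + 1 := by omega
      have h3 : n - j = (n - (j + 1)) + 1 := by omega
      simp only [instAux, if_neg h1, if_neg h2, h3, List.getElem?_cons_succ, List.length_cons]
      cases h4 : env[n - (j + 1)]? with
      | some t =>
        have ht := hE t (List.mem_of_getElem? h4)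
        simp only
        rw [lift_of_LC _ ht, lift_of_LC _ ht, instAux_of_LC _ (ht.mono (Nat.zero_le j))]
      | none =>
        have := List.getElem?_eq_none_iff.1 h4
        simp only [instAux]
        rw [if_neg (by omega), List.getElem?_eq_none (by simp; omega)]
        rw [List.length_singleton, Nat.sub_sub]
  | fvar x => rfl
  | fn f => rfl
  | app s t ihs iht => simp only [instAux]; rw [ihs, iht]
  | lam σ s ih => simp only [instAux]; rw [ih]
  | mapp Z e a ih => simp only [instAux]; congr 1; funext i; exact ih i j

theorem FV_instAux {E : List (Tm F)} {k : ℕ} {s : Tm F} {x : F.Vr} (hE : ∀ t ∈ E, LC 0 t)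
    (h : x ∈ (instAux E k s).FV) : x ∈ s.FV ∨ ∃ t ∈ E, x ∈ t.FV := by
  induction s generalizing k with
  | bvar n =>
    right
    simp only [instAux] at h
    split_ifs at h
    · exact absurd h (Set.notMem_empty x)
    · cases h1 : E[n - k]? with
      | some t =>
        rw [h1] at h
        have ht := List.mem_of_getElem? h1
        simp only at h
        rw [lift_of_LC _ (hE t ht)] at h
        exact ⟨t, ht, h⟩
      | none => rw [h1] at h; exact absurd h (Set.notMem_empty x)
  | fvar y => exact Or.inl h
  | fn f => exact Or.inl h
  | app s t ihs iht =>
    rcases h with h | h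
    · exact (ihs h).imp_left Or.inl
    · exact (iht h).imp_left Or.inr
  | lam σ s ih => exact ih (k := k + 1) h
  | mapp Z e a ih =>
    obtain ⟨i, hi⟩ := Set.mem_iUnion.1 h
    exact (ih i hi).imp_left fun h => Set.mem_iUnion.2 ⟨i, h⟩

theorem FV_opn {u : Tm F} {x y : F.Vr} (h : y ∈ (opn u x).FV) : y ∈ u.FV ∨ y = x := by
  rcases FV_instAux (by simp [LC]) h with h | ⟨t, ht, h⟩
  · exact Or.inl h
  · rw [List.mem_singleton.1 ht] at h; exact Or.inr h

theorem FMV_opn (u : Tm F) (x : F.Vr) (k : ℕ) : (instAux [fvar x] k u).FMV = u.FMV := by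
  induction u generalizing k with
  | bvar n =>
    simp only [instAux]
    split_ifs
    · rfl
    · cases h : [fvar x][n - k]? with
      | none => rfl
      | some t =>
        rw [List.mem_singleton.1 (List.mem_of_getElem? h)]; rfl
  | fvar x => rfl
  | fn f => rfl
  | app s t ihs iht => simp [instAux, FMV, ihs, iht]
  | lam σ s ih => simp [instAux, FMV, ih]
  | mapp Z e a ih => simp [instAux, FMV, ih]

theorem instAux_close {x : F.Vr} {k : ℕ} {s : Tm F} (h : LC k s) :
    instAux [fvar x] k (close x k s) = s := by
  induction s generalizing k with
  | bvar n =>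
    have hn : n < k := h
    simp [close, instAux, hn]
  | fvar y =>
    by_cases hy : y = x
    · simp [close, instAux, hy, lift]
    · simp [close, instAux, hy]
  | fn f => rfl
  | app s t ihs iht => simp only [close, instAux]; rw [ihs h.1, iht h.2]
  | lam σ s ih => simp only [close, instAux]; rw [ih h]
  | mapp Z e a ih => simp only [close, instAux]; congr 1; funext i; exact ih i (h i)

theorem opn_close {x : F.Vr} {s : Tm F} (h : LC 0 s) : opn (close x 0 s) x = s := instAux_close h

/-! ### Development and substitution -/

/-- The environment covers all dangling indices of `g`, so instantiation reaches only the supplied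
values. This is the meta-variable case of `subst_instAux`. -/
theorem instAux_develop {E : List (Tm F)} (hE : ∀ t ∈ E, LC 0 t) (k : ℕ) (g : Tm F) :
    ∀ (env ss : List (Tm F)), LC env.length g →
      instAux E k (develop g env ss) =
        develop g (env.map (instAux E k)) (ss.map (instAux E k)) := by
  have key : ∀ (g : Tm F) (env ss : List (Tm F)), LC env.length g →
      instAux E k (apps (instAux env 0 g) ss) =
        apps (instAux (env.map (instAux E k)) 0 g) (ss.map (instAux E k)) := by
    intro g env ss h
    rw [instAux_apps]
    congr 1
    have := instAux_instAux hE k (env := env) g 0 (by rwa [Nat.zero_add])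
    rwa [Nat.zero_add] at this
  induction g with
  | lam σ u ih =>
    intro env ss h
    cases ss with
    | nil => exact key _ env [] h
    | cons s ss => exact ih (s :: env) ss h
  | _ => intro env ss h; exact key _ env ss h

theorem subst_instAux {γ : Subst F} (hv : ∀ x, LC 0 (γ.v x)) (hm : ∀ Z, LC 0 (γ.m Z))
    (x : F.Vr) (u : Tm F) (k : ℕ) :
    (instAux [fvar x] k u).subst γ = instAux [γ.v x] k (u.subst γ) := by
  induction u generalizing k with
  | bvar n =>
    simp only [instAux, Tm.subst]
    split_ifs
    · rfl
    · cases h : n - k with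
      | zero => simp only [List.getElem?_cons_zero]; rw [lift_of_LC _ (hv x)]; rfl
      | succ m => rfl
  | fvar y => exact (instAux_of_LC _ ((hv y).mono (Nat.zero_le k))).symm
  | fn f => rfl
  | app s t ihs iht => simp only [instAux, Tm.subst]; rw [ihs, iht]
  | lam σ s ih => simp only [instAux, Tm.subst]; rw [ih]
  | mapp Z e a ih =>
    simp only [instAux, Tm.subst]
    rw [instAux_develop (by simpa using hv x) k (γ.m Z) [] _ (hm Z), List.map_ofFn]
    congr 2
    funext i
    exact ih i k

theorem subst_opn {γ : Subst F} (hv : ∀ x, LC 0 (γ.v x)) (hm : ∀ Z, LC 0 (γ.m Z))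
    (u : Tm F) (x : F.Vr) : (opn u x).subst γ = inst (u.subst γ) (γ.v x) :=
  subst_instAux hv hm x u 0

theorem subst_congr {γ δ : Subst F} {s : Tm F} (hv : ∀ x ∈ s.FV, γ.v x = δ.v x)
    (hm : γ.m = δ.m) : s.subst γ = s.subst δ := by
  induction s with
  | bvar n => rfl
  | fvar x => exact hv x rfl
  | fn f => rfl
  | app s t ihs iht =>
    simp only [Tm.subst]
    rw [ihs fun x hx => hv x (Or.inl hx), iht fun x hx => hv x (Or.inr hx)]
  | lam σ s ih => simp only [Tm.subst]; rw [ih hv]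
  | mapp Z e a ih =>
    simp only [Tm.subst]
    rw [hm]
    congr 2
    funext i
    exact ih i fun x hx => hv x (Set.mem_iUnion.2 ⟨i, hx⟩)

theorem subst_instAux_vars {θ : Subst F} (hv : ∀ x, LC 0 (θ.v x)) (ys : List F.Vr) {t : Tm F}
    (ht : t.FMV = ∅) (hfix : ∀ x ∈ t.FV, θ.v x = fvar x) (k : ℕ) :
    (instAux (ys.map fvar) k t).subst θ = instAux (ys.map θ.v) k t := by
  induction t generalizing k with
  | bvar n =>
    simp only [instAux, List.getElem?_map, List.length_map]
    split_ifs
    · rfl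
    · cases h : ys[n - k]? with
      | none => rfl
      | some y =>
        simp only [Option.map_some]
        rw [lift_of_LC _ (hv y)]; rfl
  | fvar y => exact hfix y rfl
  | fn f => rfl
  | app s t ihs iht =>
    obtain ⟨h1, h2⟩ := Set.union_empty_iff.1 ht
    simp only [instAux, Tm.subst]
    rw [ihs h1 fun x hx => hfix x (Or.inl hx), iht h2 fun x hx => hfix x (Or.inr hx)]
  | lam σ s ih => simp only [instAux, Tm.subst]; rw [ih ht hfix]
  | mapp Z e a ih => exact absurd (ht ▸ Or.inl rfl : Z ∈ (∅ : Set F.Mv)) (Set.notMem_empty Z)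

/-- A value developed at variables serves as a template: substituting into it gives the value
developed at arbitrary arguments, provided that `θ` fixes the value's own variables. -/
theorem subst_develop_vars {θ : Subst F} (hv : ∀ x, LC 0 (θ.v x)) (g : Tm F) :
    ∀ (ys xs : List F.Vr), g.FMV = ∅ → (∀ x ∈ g.FV, θ.v x = fvar x) →
      (develop g (ys.map fvar) (xs.map fvar)).subst θ = develop g (ys.map θ.v) (xs.map θ.v) := by
  have key : ∀ (g : Tm F) (ys xs : List F.Vr), g.FMV = ∅ → (∀ x ∈ g.FV, θ.v x = fvar x) →
      (apps (instAux (ys.map fvar) 0 g) (xs.map fvar)).subst θ =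
        apps (instAux (ys.map θ.v) 0 g) (xs.map θ.v) := by
    intro g ys xs hg hfix
    rw [subst_apps, subst_instAux_vars hv ys hg hfix, List.map_map]
    rfl
  induction g with
  | lam σ u ih =>
    intro ys xs hg hfix
    cases xs with
    | nil => exact key _ ys [] hg hfix
    | cons x xs => exact ih (x :: ys) xs hg hfix
  | _ => intro ys xs hg hfix; exact key _ ys xs hg hfix

end Tm

-- Reductions under application and β-steps of developed values

theorem Step.apps {R : Set (Rule F)} {s t : Tm F} (h : Step R s t) (us : List (Tm F)) :
    Step R (Tm.apps s us) (Tm.apps t us) := by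
  induction us generalizing s t with
  | nil => exact h
  | cons u us ih => exact ih (h.appLeft u)

theorem Steps.apps {R : Set (Rule F)} {s t : Tm F} (h : Steps R s t) (us : List (Tm F)) :
    Steps R (Tm.apps s us) (Tm.apps t us) := by
  induction h with
  | refl => exact .refl
  | tail _ h ih => exact ih.tail (h.apps us)

/-- Arguments in excess of those developed are absorbed by β as long as abstractions remain; after
that both sides are the same application. -/
theorem Tm.steps_develop (R : Set (Rule F)) (g : Tm F) :
    ∀ env as bs : List (Tm F), (∀ t ∈ env, LC 0 t) → (∀ t ∈ as, LC 0 t) → (∀ t ∈ bs, LC 0 t) →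
      Steps R (apps (develop g env as) bs) (develop g env (as ++ bs)) := by
  induction g with
  | lam σ u ih =>
    intro env as bs he ha hb
    cases as with
    | cons a as =>
      simp only [List.mem_cons, forall_eq_or_imp] at ha
      exact ih (a :: env) as bs (by simpa using ⟨ha.1, he⟩) ha.2 hb
    | nil =>
      cases bs with
      | nil => exact .refl
      | cons b bs =>
        simp only [List.mem_cons, forall_eq_or_imp] at hb
        refine .head (Step.apps (.beta σ (instAux env 1 u) b) bs) ?_
        rw [inst, inst_instAux_succ b he]
        have := ih (b :: env) [] bs (by simpa using ⟨hb.1, he⟩) (by simp) hb.2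
        -- With no arguments left, `develop` unfolds to the plain instance only once the shape of
        -- `u` is known.
        cases u <;> exact this
  | _ =>
    intro env as bs _ _ _
    simp only [develop, apps_append]
    exact .refl

/-! ### Types -/

namespace Ty

variable {S : Type u₁}

@[simp] theorem arrows_nil (τ : Ty S) : arrows [] τ = τ := rfl

@[simp] theorem arrows_cons (σ : Ty S) (σs : List (Ty S)) (τ : Ty S) :
    arrows (σ :: σs) τ = arrow σ (arrows σs τ) := rfl

theorem arrows_append (σs ρs : List (Ty S)) (τ : Ty S) :
    arrows (σs ++ ρs) τ = arrows σs (arrows ρs τ) := by simp [arrows]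

theorem argTys_arrows (σs : List (Ty S)) (τ : Ty S) :
    (arrows σs τ).argTys = σs ++ τ.argTys := by
  induction σs with
  | nil => rfl
  | cons σ σs ih => simp [argTys, ih]

theorem target_arrows (σs : List (Ty S)) (τ : Ty S) : (arrows σs τ).target = τ.target := by
  induction σs with
  | nil => rfl
  | cons σ σs ih => simpa [target] using ih

theorem arrows_argTys_target (σ : Ty S) : arrows σ.argTys (base σ.target) = σ := by
  induction σ with
  | base ι => rfl
  | arrow σ τ _ ih => simp [argTys, target, ih]

theorem arrows_inj {σs ρs : List (Ty S)} {τ υ : Ty S} (hl : σs.length = ρs.length)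
    (h : arrows σs τ = arrows ρs υ) : σs = ρs ∧ τ = υ := by
  induction σs generalizing ρs with
  | nil =>
    cases ρs with
    | nil => exact ⟨rfl, h⟩
    | cons ρ ρs => simp at hl
  | cons σ σs ih =>
    cases ρs with
    | nil => simp at hl
    | cons ρ ρs =>
      simp only [arrows_cons, arrow.injEq] at h
      obtain ⟨h1, h2⟩ := ih (by simpa using hl) h.2
      exact ⟨by rw [h.1, h1], h2⟩

end Ty

open Ty

/-! ### Typing -/

namespace Tm

theorem HasType.unique {Γ : List (Ty F.Srt)} {s : Tm F} {σ τ : Ty F.Srt} (h : HasType Γ s σ)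
    (h' : HasType Γ s τ) : σ = τ := by
  induction h generalizing τ with
  | bvar h => cases h' with | bvar h' => exact Option.some.inj (h.symm.trans h')
  | fvar x => cases h'; rfl
  | fn f => cases h'; rfl
  | app h1 h2 ih1 ih2 => cases h' with | app h1' h2' => exact (Ty.arrow.inj (ih1 h1')).2
  | lam h ih => cases h' with | lam h' => rw [ih h']
  | mapp σs _ hZ _ _ =>
    cases h' with
    | mapp ρs _ hZ' _ => exact (arrows_inj (by simp) (hZ.symm.trans hZ')).2

theorem HasType.lc {Γ : List (Ty F.Srt)} {s : Tm F} {σ : Ty F.Srt} (h : HasType Γ s σ) :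
    LC Γ.length s := by
  induction h with
  | bvar h => exact (List.getElem?_eq_some_iff.1 h).1
  | fvar x => trivial
  | fn f => trivial
  | app h1 h2 ih1 ih2 => exact ⟨ih1, ih2⟩
  | lam h ih => exact ih
  | mapp σs _ hZ _ ih => exact ih

theorem hasType_apps {Γ : List (Ty F.Srt)} {s : Tm F} {ts : List (Tm F)} {τ : Ty F.Srt} :
    HasType Γ (apps s ts) τ ↔
      ∃ σs, HasType Γ s (arrows σs τ) ∧ List.Forall₂ (HasType Γ) ts σs := by
  induction ts generalizing s with
  | nil =>
    constructor
    · exact fun h => ⟨[], h, .nil⟩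
    · rintro ⟨σs, h, h'⟩; cases h'; exact h
  | cons t ts ih =>
    rw [apps_cons, ih]
    constructor
    · rintro ⟨σs, h, h'⟩
      cases h with
      | @app _ _ _ σ _ h1 h2 => exact ⟨σ :: σs, h1, .cons h2 h'⟩
    · rintro ⟨σs, h, h'⟩
      cases h' with
      | cons h2 h' => exact ⟨_, .app h h2, h'⟩

theorem HasType.weaken {Γ : List (Ty F.Srt)} {s : Tm F} {σ : Ty F.Srt} (h : HasType Γ s σ)
    (Δ : List (Ty F.Srt)) : HasType (Γ ++ Δ) s σ := by
  induction h with
  | bvar h =>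
    exact .bvar (by rw [List.getElem?_append_left (List.getElem?_eq_some_iff.1 h).1]; exact h)
  | fvar x => exact .fvar x
  | fn f => exact .fn f
  | app h1 h2 ih1 ih2 => exact .app ih1 ih2
  | lam h ih => exact .lam ih
  | mapp σs h hZ _ ih => exact .mapp σs h hZ ih

theorem HasType.lift {Δ Γ : List (Ty F.Srt)} {s : Tm F} {σ : Ty F.Srt} (h : HasType (Δ ++ Γ) s σ)
    (Θ : List (Ty F.Srt)) : HasType (Δ ++ (Θ ++ Γ)) (lift Θ.length Δ.length s) σ := by
  induction s generalizing Δ σ with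
  | bvar n =>
    cases h with
    | bvar h =>
      simp only [Tm.lift]
      split_ifs with hn
      · exact .bvar (by rwa [List.getElem?_append_left hn] at h ⊢)
      · rw [List.getElem?_append_right (by omega)] at h
        refine .bvar ?_
        rw [List.getElem?_append_right (by omega), List.getElem?_append_right (by omega), ← h]
        congr 1
        omega
  | fvar x => cases h; exact .fvar x
  | fn f => cases h; exact .fn f
  | app s t ihs iht => cases h with | app h1 h2 => exact .app (ihs h1) (iht h2)
  | lam ρ s ih => cases h with | lam h => exact .lam (ih (Δ := ρ :: Δ) h)
  | mapp Z e a ih =>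
    cases h with | mapp σs h hZ ha => exact .mapp σs h hZ fun i => ih i (ha i)

theorem HasType.instAux {Δ Θ Γ : List (Ty F.Srt)} {s : Tm F} {σ : Ty F.Srt} {env : List (Tm F)}
    (h : HasType (Δ ++ (Θ ++ Γ)) s σ) (he : List.Forall₂ (HasType Γ) env Θ) :
    HasType (Δ ++ Γ) (instAux env Δ.length s) σ := by
  induction s generalizing Δ σ with
  | bvar n =>
    cases h with
    | bvar h =>
      simp only [Tm.instAux]
      split_ifs with hn
      · exact .bvar (by rwa [List.getElem?_append_left hn] at h ⊢)
      · rw [List.getElem?_append_right (by omega)] at h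
        have hl := he.length_eq
        by_cases h1 : n - Δ.length < env.length
        · rw [List.getElem?_append_left (by omega), List.getElem?_eq_getElem (by omega)] at h
          rw [List.getElem?_eq_getElem h1]
          have := List.Forall₂.get he h1 (by omega)
          rw [List.get_eq_getElem, List.get_eq_getElem, Option.some.inj h] at this
          exact HasType.lift (Δ := []) this Δ
        · rw [List.getElem?_append_right (by omega)] at h
          rw [List.getElem?_eq_none (by omega)]
          refine .bvar ?_
          rw [List.getElem?_append_right (by omega), ← h]
          congr 1
          omega
  | fvar x => cases h; exact .fvar x
  | fn f => cases h; exact .fn f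
  | app s t ihs iht => cases h with | app h1 h2 => exact .app (ihs h1) (iht h2)
  | lam ρ s ih => cases h with | lam h => exact .lam (ih (Δ := ρ :: Δ) h)
  | mapp Z e a ih =>
    cases h with | mapp σs h hZ ha => exact .mapp σs h hZ fun i => ih i (ha i)

theorem HasType.inst {Γ : List (Ty F.Srt)} {u t : Tm F} {σ τ : Ty F.Srt}
    (h : HasType (σ :: Γ) u τ) (ht : HasType Γ t σ) : HasType Γ (inst u t) τ :=
  HasType.instAux (Δ := []) (Θ := [σ]) h (.cons ht .nil)

theorem HasType.opn {Γ : List (Ty F.Srt)} {u : Tm F} {x : F.Vr} {τ : Ty F.Srt}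
    (h : HasType (F.vrTy x :: Γ) u τ) : HasType Γ (opn u x) τ :=
  h.inst (HasType.fvar x)

/-- Freshness of `x` plays no part, since names carry their types. Subject reduction under an
abstraction depends on this converse of `HasType.opn`. -/
theorem HasType.of_opn {Δ Γ : List (Ty F.Srt)} {x : F.Vr} {u : Tm F} {τ : Ty F.Srt}
    (h : HasType (Δ ++ Γ) (Tm.instAux [Tm.fvar x] Δ.length u) τ) :
    HasType (Δ ++ F.vrTy x :: Γ) u τ := by
  induction u generalizing Δ τ with
  | bvar n =>
    refine .bvar ?_
    rcases lt_trichotomy n Δ.length with hn | hn | hn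
    · simp only [Tm.instAux, if_pos hn] at h
      cases h with
      | bvar h => rwa [List.getElem?_append_left hn] at h ⊢
    · subst hn
      simp only [Tm.instAux, lt_irrefl, if_false, Nat.sub_self, List.getElem?_cons_zero] at h
      cases h
      simp
    · obtain ⟨m, rfl⟩ : ∃ m, n = Δ.length + (m + 1) := ⟨n - Δ.length - 1, by omega⟩
      simp only [Tm.instAux, Nat.not_lt.2 hn.le, if_false, Nat.add_sub_cancel_left,
        List.getElem?_cons_succ, List.getElem?_nil, List.length_singleton] at h
      cases h with
      | bvar h =>
        rw [List.getElem?_append_right (by omega)] at h ⊢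
        rw [← h, Nat.add_sub_cancel_left, List.getElem?_cons_succ]
        congr 1
        omega
  | fvar x => cases h; exact .fvar x
  | fn f => cases h; exact .fn f
  | app s t ihs iht => cases h with | app h1 h2 => exact .app (ihs h1) (iht h2)
  | lam ρ s ih => cases h with | lam h => exact .lam (ih (Δ := ρ :: Δ) h)
  | mapp Z e a ih =>
    cases h with | mapp σs h hZ ha => exact .mapp σs h hZ fun i => ih i (ha i)

theorem hasType_develop {Γ : List (Ty F.Srt)} (g : Tm F) :
    ∀ (env : List (Tm F)) (Θ : List (Ty F.Srt)) (ss : List (Tm F)) (σs : List (Ty F.Srt))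
      (τ : Ty F.Srt), HasType Θ g (arrows σs τ) → List.Forall₂ (HasType Γ) env Θ →
      List.Forall₂ (HasType Γ) ss σs → HasType Γ (develop g env ss) τ := by
  have key : ∀ (g : Tm F) (env : List (Tm F)) (Θ : List (Ty F.Srt)) (ss : List (Tm F))
      (σs : List (Ty F.Srt)) (τ : Ty F.Srt), HasType Θ g (arrows σs τ) →
      List.Forall₂ (HasType Γ) env Θ → List.Forall₂ (HasType Γ) ss σs →
      HasType Γ (apps (instAux env 0 g) ss) τ := fun g env Θ ss σs τ hg he hs =>
    hasType_apps.2 ⟨σs, HasType.instAux (Δ := []) (hg.weaken Γ) he, hs⟩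
  induction g with
  | lam ρ u ih =>
    intro env Θ ss σs τ hg he hs
    cases hs with
    | nil => exact key _ env Θ [] [] τ hg he .nil
    | cons h hs =>
      cases hg with | lam hg => exact ih _ _ _ _ _ hg (.cons h he) hs
  | _ => exact key _

theorem HasType.subst {γ : Subst F} (hv : ∀ x, HasType [] (γ.v x) (F.vrTy x))
    (hm : ∀ Z, HasType [] (γ.m Z) (F.mvTy Z)) {Γ : List (Ty F.Srt)} {s : Tm F} {σ : Ty F.Srt}
    (h : HasType Γ s σ) : HasType Γ (s.subst γ) σ := by
  induction h with
  | bvar h => exact .bvar h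
  | fvar x => exact (hv x).weaken _
  | fn f => exact .fn f
  | app h1 h2 ih1 ih2 => exact .app ih1 ih2
  | lam h ih => exact .lam ih
  | @mapp Γ Z e a τ σs _ hZ _ ih =>
    refine hasType_develop _ [] [] _ _ _ (hZ ▸ hm Z) .nil ?_
    exact List.forall₂_iff_get.2 ⟨by simp, fun i h1 h2 => by simpa using ih _⟩

theorem FMV_lift (d c : ℕ) (s : Tm F) : (lift d c s).FMV = s.FMV := by
  induction s generalizing c with
  | bvar n => simp only [lift]; split_ifs <;> rfl
  | fvar x => rfl
  | fn f => rfl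
  | app s t ihs iht => simp [lift, FMV, ihs, iht]
  | lam σ s ih => simp [lift, FMV, ih]
  | mapp Z e a ih => simp [lift, FMV, ih]

theorem FMV_instAux {E : List (Tm F)} (hE : ∀ t ∈ E, t.FMV = ∅) {s : Tm F} (hs : s.FMV = ∅)
    (k : ℕ) : (instAux E k s).FMV = ∅ := by
  induction s generalizing k with
  | bvar n =>
    simp only [instAux]
    split_ifs
    · rfl
    · cases h : E[n - k]? with
      | none => rfl
      | some t => exact (FMV_lift k 0 t).trans (hE t (List.mem_of_getElem? h))
  | fvar x => rfl
  | fn f => rfl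
  | app s t ihs iht =>
    obtain ⟨h1, h2⟩ := Set.union_empty_iff.1 hs
    exact Set.union_empty_iff.2 ⟨ihs h1 k, iht h2 k⟩
  | lam σ s ih => exact ih hs (k + 1)
  | mapp Z e a ih => exact absurd (hs ▸ Or.inl rfl : Z ∈ (∅ : Set F.Mv)) (Set.notMem_empty Z)

theorem FMV_apps_eq_empty {s : Tm F} {ts : List (Tm F)} :
    (apps s ts).FMV = ∅ ↔ s.FMV = ∅ ∧ ∀ t ∈ ts, t.FMV = ∅ := by
  simp only [Set.eq_empty_iff_forall_notMem, FMV_apps]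
  constructor
  · exact fun h => ⟨fun Z hZ => h Z (Or.inl hZ), fun t ht Z hZ => h Z (Or.inr ⟨t, ht, hZ⟩)⟩
  · rintro ⟨h1, h2⟩ Z (hZ | ⟨t, ht, hZ⟩)
    exacts [h1 Z hZ, h2 t ht Z hZ]

theorem FMV_develop (g : Tm F) : ∀ env ss : List (Tm F), g.FMV = ∅ → (∀ t ∈ env, t.FMV = ∅) →
    (∀ t ∈ ss, t.FMV = ∅) → (develop g env ss).FMV = ∅ := by
  have key : ∀ (g : Tm F) (env ss : List (Tm F)), g.FMV = ∅ → (∀ t ∈ env, t.FMV = ∅) →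
      (∀ t ∈ ss, t.FMV = ∅) → (apps (instAux env 0 g) ss).FMV = ∅ := fun g env ss hg he hs =>
    FMV_apps_eq_empty.2 ⟨FMV_instAux he hg 0, hs⟩
  induction g with
  | lam ρ u ih =>
    intro env ss hg he hs
    cases ss with
    | nil => exact key _ env [] hg he hs
    | cons s ss =>
      simp only [List.mem_cons, forall_eq_or_imp] at hs
      exact ih (s :: env) ss hg (by simpa using ⟨hs.1, he⟩) hs.2
  | _ => exact key _

theorem FMV_subst {γ : Subst F} {s : Tm F} (hv : ∀ x ∈ s.FV, (γ.v x).FMV = ∅)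
    (hm : ∀ Z ∈ s.FMV, (γ.m Z).FMV = ∅) : (s.subst γ).FMV = ∅ := by
  induction s with
  | bvar n => rfl
  | fvar x => exact hv x rfl
  | fn f => rfl
  | app s t ihs iht =>
    exact Set.union_empty_iff.2 ⟨ihs (fun x hx => hv x (Or.inl hx)) fun Z hZ => hm Z (Or.inl hZ),
      iht (fun x hx => hv x (Or.inr hx)) fun Z hZ => hm Z (Or.inr hZ)⟩
  | lam σ s ih => exact ih hv hm
  | mapp Z e a ih =>
    refine FMV_develop _ _ _ (hm Z (Or.inl rfl)) (by simp) fun t ht => ?_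
    obtain ⟨i, rfl⟩ := List.mem_ofFn.1 ht
    exact ih i (fun x hx => hv x (Set.mem_iUnion.2 ⟨i, hx⟩))
      fun Z hZ => hm Z (Or.inr (Set.mem_iUnion.2 ⟨i, hZ⟩))

theorem isTermOf_apps {s : Tm F} {ts : List (Tm F)} {τ : Ty F.Srt} :
    IsTermOf (apps s ts) τ ↔ ∃ σs, IsTermOf s (arrows σs τ) ∧ List.Forall₂ IsTermOf ts σs := by
  constructor
  · rintro ⟨h, h'⟩
    obtain ⟨σs, h1, h2⟩ := hasType_apps.1 h
    obtain ⟨h3, h4⟩ := FMV_apps_eq_empty.1 h'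
    refine ⟨σs, ⟨h1, h3⟩, ?_⟩
    clear h h' h1 h3
    induction h2 with
    | nil => exact .nil
    | cons h _ ih =>
      simp only [List.mem_cons, forall_eq_or_imp] at h4
      exact .cons ⟨h, h4.1⟩ (ih h4.2)
  · rintro ⟨σs, h1, h2⟩
    refine ⟨hasType_apps.2 ⟨σs, h1.1, h2.imp fun _ _ h => h.1⟩, FMV_apps_eq_empty.2 ⟨h1.2, ?_⟩⟩
    clear h1
    induction h2 with
    | nil => simp
    | cons h _ ih => simpa using ⟨h.2, ih⟩

theorem isTermOf_app {s t : Tm F} {τ : Ty F.Srt} :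
    IsTermOf (app s t) τ ↔ ∃ σ, IsTermOf s (.arrow σ τ) ∧ IsTermOf t σ := by
  constructor
  · rintro ⟨h, h'⟩
    obtain ⟨h3, h4⟩ := Set.union_empty_iff.1 h'
    cases h with | app h1 h2 => exact ⟨_, ⟨h1, h3⟩, h2, h4⟩
  · rintro ⟨σ, h1, h2⟩
    exact ⟨.app h1.1 h2.1, Set.union_empty_iff.2 ⟨h1.2, h2.2⟩⟩

end Tm

/-! ### Subject reduction -/

theorem Subst.IsSubst.fmv_v {γ : Subst F} (h : γ.IsSubst) (x : F.Vr) : (γ.v x).FMV = ∅ := by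
  by_cases hx : x ∈ γ.domV
  · exact h.2.1 x hx
  · rw [not_not.1 (show ¬ γ.v x ≠ fvar x from hx)]; rfl

theorem Step.isTermOf {R : Set (Rule F)} {s t : Tm F} (h : Step R s t) {σ : Ty F.Srt}
    (hs : s.IsTermOf σ) : t.IsTermOf σ := by
  induction h generalizing σ with
  | @rule ρ δ _ hδ _ hM =>
    obtain ⟨τ, hl, hr⟩ := ρ.same_type
    have hm := fun Z => (hδ.1.2 Z).1
    obtain rfl := hs.1.unique (HasType.subst hδ.1.1 hm hl)
    exact ⟨HasType.subst hδ.1.1 hm hr, FMV_subst (fun x _ => hδ.fmv_v x)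
      fun Z hZ => hδ.2.2 Z (hM ▸ ρ.fmv_subset hZ)⟩
  | beta ρ u v =>
    obtain ⟨τ, ⟨h1, h2⟩, h3⟩ := isTermOf_app.1 hs
    cases h1 with
    | lam h1 => exact ⟨h1.inst h3.1, FMV_instAux (s := u) (by simpa using h3.2) h2 0⟩
  | appLeft u _ ih =>
    obtain ⟨τ, h1, h2⟩ := isTermOf_app.1 hs
    exact isTermOf_app.2 ⟨τ, ih h1, h2⟩
  | appRight u _ ih =>
    obtain ⟨τ, h1, h2⟩ := isTermOf_app.1 hs
    exact isTermOf_app.2 ⟨τ, h1, ih h2⟩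
  | @lam ρ u u' x hx _ _ _ ih =>
    subst hx
    obtain ⟨h1, h2⟩ := hs
    cases h1 with
    | lam h1 =>
      obtain ⟨h3, h4⟩ := ih ⟨h1.opn, (FMV_opn u x 0).trans h2⟩
      exact ⟨.lam (HasType.of_opn (Δ := []) h3), (FMV_opn u' x 0).symm.trans h4⟩

/-! ### Computability -/

/-- Strong normalisation, as accessibility. -/
def SN (R : Set (Rule F)) (s : Tm F) : Prop := Acc (fun t s => Step R s t) s

theorem acc_of_terminatingAt {r : Tm F → Tm F → Prop} {s : Tm F} (h : TerminatingAt r s) :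
    Acc (fun a b => r b a) s := by
  by_contra hs
  obtain ⟨q, hq⟩ := not_acc_iff_exists_descending_chain.1 hs
  exact h ⟨q, hq⟩

theorem SN.of_app {R : Set (Rule F)} {s t : Tm F} (h : SN R (app s t)) : SN R s := by
  unfold SN at h
  generalize hw : app s t = w at h
  induction h generalizing s with
  | intro w _ ih => subst hw; exact ⟨_, fun s' hs => ih _ (hs.appLeft t) rfl⟩

theorem Rule.head_lhs_subst (ρ : Rule F) (δ : Subst F) (x : F.Vr) :
    (ρ.lhs.subst δ).head ≠ fvar x := by
  obtain ⟨f, ls, h⟩ := ρ.lhs_form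
  rw [h, subst_apps, head_apps]
  exact nofun

theorem Step.head_eq_fvar {R : Set (Rule F)} {s t : Tm F} (h : Step R s t) {x : F.Vr}
    (hs : s.head = fvar x) : t.head = fvar x := by
  induction h with
  | rule => exact absurd hs (Rule.head_lhs_subst _ _ x)
  | beta => exact absurd hs nofun
  | appLeft t _ ih => exact ih hs
  | appRight s _ => exact hs
  | lam => exact absurd hs nofun

/-- A variable head admits neither a rule nor a β-step at the root and survives reduction, so all
steps take place in `s` or in `t`. -/
theorem SN.app_of_head {R : Set (Rule F)} {s t : Tm F} {x : F.Vr} (hs : SN R s)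
    (hx : s.head = fvar x) (ht : SN R t) : SN R (app s t) := by
  induction hs generalizing t with
  | intro s hs ihs =>
    induction ht with
    | intro t ht iht =>
      refine ⟨_, fun w hw => ?_⟩
      generalize hv : app s t = v at hw
      cases hw with
      | rule => exact absurd ((congrArg Tm.head hv).symm.trans hx) (Rule.head_lhs_subst _ _ x)
      | beta σ u v => injection hv with h1 h2; subst h1; exact absurd hx nofun
      | appLeft t' h =>
        injection hv with h1 h2
        subst h1 h2
        exact ihs _ h (h.head_eq_fvar hx) ⟨t, ht⟩
      | appRight s' h => injection hv with h1 h2; subst h1 h2; exact iht _ h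
      | lam => cases hv

theorem SN.apps_fvar {R : Set (Rule F)} (x : F.Vr) (ts : List (Tm F)) (h : ∀ t ∈ ts, SN R t) :
    SN R (apps (fvar x) ts) := by
  induction ts using List.reverseRecOn with
  | nil =>
    refine ⟨_, fun w hw => ?_⟩
    generalize hv : Tm.apps (fvar x) [] = v at hw
    cases hw with
    | rule => exact absurd (congrArg Tm.head hv.symm) (Rule.head_lhs_subst _ _ x)
    | _ => cases hv
  | append_singleton ts t ih =>
    rw [apps_append]
    exact (ih fun u hu => h u (by simp [hu])).app_of_head (head_apps _ _) (h t (by simp))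

theorem CompAt.isTermOf {I : Set (Tm F)} {σ : Ty F.Srt} {s : Tm F} (h : CompAt I σ s) :
    s.IsTermOf σ := by
  cases σ <;> exact h.1

theorem Comp.compAt {I : Set (Tm F)} {σ : Ty F.Srt} {s : Tm F} (h : Comp I s)
    (hs : HasType [] s σ) : CompAt I σ s := by
  obtain ⟨τ, h⟩ := h
  exact h.isTermOf.1.unique hs ▸ h

theorem exists_vr (σ : Ty F.Srt) : ∃ x, F.vrTy x = σ := (F.vr_infinite σ).nonempty

section

variable {R : Set (Rule F)} {I : Set (Tm F)}

theorem CompAt.step (hI : IsRCSet R I) {σ : Ty F.Srt} {s t : Tm F} (h : CompAt I σ s)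
    (hst : Step R s t) : CompAt I σ t := by
  induction σ generalizing s t with
  | base ι => exact ⟨hst.isTermOf h.1, hI.closed s h.2 t hst⟩
  | arrow σ τ _ ih => exact ⟨hst.isTermOf h.1, fun u hu => ih (h.2 u hu) (hst.appLeft u)⟩

theorem IsRCSet.mem_of_sn (hI : IsRCSet R I) {s : Tm F} {x : F.Vr} {ι : F.Srt} (hs : SN R s)
    (hx : s.head = fvar x) (hι : s.IsTermOf (.base ι)) : s ∈ I := by
  induction hs with
  | intro s _ ih =>
    refine hI.neutral s ι hι (Or.inl ⟨x, s.args, ?_⟩) fun t hst =>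
      ih t hst (hst.head_eq_fvar hx) (hst.isTermOf hι)
    rw [← hx, apps_head_args]

/-- The usual joint induction on types: termination at an arrow type needs a computable argument,
namely a variable, and computability of `x ss` at an arrow type needs termination of the next
argument. -/
theorem compAt_sn_and_fvar (hI : IsRCSet R I) (σ : Ty F.Srt) :
    (∀ s, CompAt I σ s → SN R s) ∧
    ∀ x ss, (apps (fvar x) ss).IsTermOf σ → (∀ s ∈ ss, SN R s) → CompAt I σ (apps (fvar x) ss) := by
  induction σ with
  | base ι =>
    refine ⟨fun s hs => acc_of_terminatingAt (hI.terminating s hs.2), fun x ss h hss => ⟨h, ?_⟩⟩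
    exact hI.mem_of_sn (SN.apps_fvar x ss hss) (head_apps _ _) h
  | arrow σ τ ihσ ihτ =>
    constructor
    · intro s hs
      obtain ⟨x, rfl⟩ := exists_vr σ
      exact (ihτ.1 _ (hs.2 _ (ihσ.2 x [] ⟨.fvar x, rfl⟩ (by simp)))).of_app
    · refine fun x ss h hss => ⟨h, fun t ht => ?_⟩
      have := ihτ.2 x (ss ++ [t])
      rw [apps_append] at this
      refine this (isTermOf_app.2 ⟨σ, h, ht.isTermOf⟩) fun s hs => ?_
      rcases List.mem_append.1 hs with hs | hs
      · exact hss s hs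
      · rw [List.mem_singleton.1 hs]; exact ihσ.1 t ht

theorem compAt_fvar (hI : IsRCSet R I) (x : F.Vr) : CompAt I (F.vrTy x) (fvar x) :=
  (compAt_sn_and_fvar hI _).2 x [] ⟨.fvar x, rfl⟩ (by simp)

/-- Supplies the arguments that bring a functional term down to base type, where `⇛_C` is defined.
-/
theorem exists_compAt_list (hI : IsRCSet R I) (σs : List (Ty F.Srt)) :
    ∃ ts, List.Forall₂ (fun t σ => CompAt I σ t) ts σs := by
  induction σs with
  | nil => exact ⟨[], .nil⟩
  | cons σ σs ih =>
    obtain ⟨ts, hts⟩ := ih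
    obtain ⟨x, rfl⟩ := exists_vr σ
    exact ⟨_, .cons (compAt_fvar hI x) hts⟩

theorem Tm.LC.close {x : F.Vr} {k : ℕ} {s : Tm F} (h : LC k s) : LC (k + 1) (close x k s) := by
  induction s generalizing k with
  | bvar n =>
    have hn : n < k := h
    simp only [Tm.close, if_pos hn]
    exact hn.trans (Nat.lt_succ_self k)
  | fvar y =>
    simp only [Tm.close]
    split_ifs
    · exact Nat.lt_succ_self k
    · trivial
  | fn f => trivial
  | app s t ihs iht => exact ⟨ihs h.1, iht h.2⟩
  | lam σ s ih => exact ih (k := k + 1) h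
  | mapp Z e a ih => exact fun i => ih i (h i)

theorem Tm.LC.absList (xs : List F.Vr) {s : Tm F} (h : LC 0 s) : LC 0 (absList xs s) := by
  induction xs with
  | nil => exact h
  | cons x xs ih => exact LC.close (k := 0) ih

/-- Applying the abstraction to the computable values `γ(x)` and contracting recovers `vγ`;
computability is closed under reduction. -/
theorem Comp.of_absList (hI : IsRCSet R I) {γ : Subst F}
    (hv : ∀ x, CompAt I (F.vrTy x) (γ.v x)) (hm : ∀ Z, LC 0 (γ.m Z)) (xs : List F.Vr) {v : Tm F}
    (hlc : LC 0 v) (h : Comp I ((absList xs v).subst γ)) : Comp I (v.subst γ) := by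
  induction xs with
  | nil => exact h
  | cons x xs ih =>
    apply ih
    obtain ⟨σ, h⟩ := h
    have ht := h.isTermOf.1
    cases ht with
    | @lam _ _ _ τ ht =>
      have hstep := Step.beta (R := R) (F.vrTy x) ((Tm.close x 0 (Tm.absList xs v)).subst γ) (γ.v x)
      rw [← subst_opn (fun y => (hv y).isTermOf.1.lc) hm, opn_close (LC.absList xs hlc)] at hstep
      exact ⟨τ, (h.2 _ (hv x)).step hI hstep⟩

end

/-! ### The sort ordering -/

theorem Framework.gt_of_ge_of_gt {ι κ μ : F.Srt} (h : F.ge ι κ) (h' : F.gt κ μ) : F.gt ι μ :=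
  ⟨F.ge_trans _ _ _ h h'.1, fun h'' => h'.2 (F.ge_trans _ _ _ h'' h)⟩

theorem Framework.gt_of_gt_of_ge {ι κ μ : F.Srt} (h : F.gt ι κ) (h' : F.ge κ μ) : F.gt ι μ :=
  ⟨F.ge_trans _ _ _ h.1 h', fun h'' => h.2 (F.ge_trans _ _ _ h' h'')⟩

theorem gePos_gtNeg_mono {ι κ : F.Srt} (h : F.ge ι κ) (σ : Ty F.Srt) :
    (GePos κ σ → GePos ι σ) ∧ (GtNeg κ σ → GtNeg ι σ) := by
  induction σ with
  | base μ =>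
    simp only [GePos, GtNeg]
    exact ⟨F.ge_trans _ _ _ h, F.gt_of_ge_of_gt h⟩
  | arrow σ τ ihσ ihτ =>
    simp only [GePos, GtNeg]
    exact ⟨And.imp ihσ.2 ihτ.1, And.imp ihσ.1 ihτ.2⟩

theorem GePos.ge_target {ι : F.Srt} {σ : Ty F.Srt} (h : GePos ι σ) : F.ge ι σ.target := by
  induction σ with
  | base μ => simp only [GePos] at h; exact h
  | arrow σ τ _ ih => simp only [GePos] at h; exact ih h.2

theorem GtNeg.gt_target {ι : F.Srt} {σ : Ty F.Srt} (h : GtNeg ι σ) : F.gt ι σ.target := by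
  induction σ with
  | base μ => simp only [GtNeg] at h; exact h
  | arrow σ τ _ ih => simp only [GtNeg] at h; exact ih h.2

/-! ### Accessible subterms -/

theorem Tm.HasType.arg {Γ : List (Ty F.Srt)} {a s : Tm F} {ss : List (Tm F)} {σ υ ρ : Ty F.Srt}
    {i : ℕ} (h : HasType Γ (apps a ss) σ) (ha : HasType Γ a υ) (hs : ss[i]? = some s)
    (hρ : υ.argTys[i]? = some ρ) : HasType Γ s ρ ∧ υ.target = σ.target := by
  obtain ⟨σs, h1, h2⟩ := hasType_apps.1 h
  obtain rfl := ha.unique h1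
  refine ⟨?_, target_arrows σs σ⟩
  obtain ⟨hi, rfl⟩ := List.getElem?_eq_some_iff.1 hs
  have hi' : i < σs.length := h2.length_eq ▸ hi
  rw [argTys_arrows, List.getElem?_append_left hi', List.getElem?_eq_getElem hi'] at hρ
  obtain rfl := Option.some.inj hρ
  exact List.Forall₂.get h2 hi hi'

theorem AccSub.target_ge {s t : Tm F} (h : AccSub s t) {σ : Ty F.Srt} (hs : HasType [] s σ) :
    ∃ τ, HasType [] t τ ∧ F.ge σ.target τ.target := by
  induction h generalizing σ with
  | refl s => exact ⟨σ, hs, F.ge_refl _⟩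
  | lam x hx _ _ ih => subst hx; cases hs with | lam hs => have := ih hs.opn; exact this
  | @fn f ss i s t hi hsi _ ih =>
    obtain ⟨ρ, hρ, hpos⟩ := hi
    obtain ⟨h1, h2⟩ := hs.arg (.fn f) hsi hρ
    obtain ⟨τ, h3, h4⟩ := ih h1
    exact ⟨τ, h3, F.ge_trans _ _ _ (h2 ▸ hpos.ge_target) h4⟩
  | @vr x ss i s t hi hsi _ ih =>
    obtain ⟨ρ, hρ, hpos⟩ := hi
    obtain ⟨h1, h2⟩ := hs.arg (.fvar x) hsi hρ
    obtain ⟨τ, h3, h4⟩ := ih h1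
    exact ⟨τ, h3, F.ge_trans _ _ _ (h2 ▸ hpos) h4⟩

/-- Accessible subterms that are reached through arguments of function symbols only. -/
inductive FnAccSub : Tm F → Tm F → Prop
  | refl (s) : FnAccSub s s
  | lam {σ u t} (x : F.Vr) : F.vrTy x = σ → FnAccSub (opn u x) t → FnAccSub (lam σ u) t
  | fn {f ss i s t} : i ∈ AccFn f → ss[i]? = some s → FnAccSub s t → FnAccSub (apps (fn f) ss) t

/-- Reaching a subterm through an argument of a variable decreases the sort. -/
theorem AccSub.fnAccSub_or_gt {s t : Tm F} (h : AccSub s t) {ι : F.Srt} {σ : Ty F.Srt}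
    (hs : HasType [] s σ) (hσ : GePos ι σ) (hFV : ∀ x ∈ s.FV, GtNeg ι (F.vrTy x)) :
    FnAccSub s t ∨ ∃ τ, HasType [] t τ ∧ F.gt ι τ.target := by
  induction h generalizing σ with
  | refl s => exact Or.inl (.refl s)
  | lam x hx _ _ ih =>
    subst hx
    cases hs with
    | lam hs =>
      simp only [GePos] at hσ
      refine (ih hs.opn hσ.2 fun y hy => ?_).imp_left (FnAccSub.lam x rfl)
      -- The variable freed here has the domain type of `σ`, for which `GePos` at an arrow type
      -- demands `GtNeg`.
      rcases FV_opn hy with hy | rfl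
      · exact hFV y hy
      · exact hσ.1
  | @fn f ss i s t hi hsi _ ih =>
    obtain ⟨ρ, hρ, hpos⟩ := id hi
    obtain ⟨h1, h2⟩ := hs.arg (.fn f) hsi hρ
    -- Accessibility is measured against the output sort of `f`, which may lie below `ι`;
    -- monotonicity transfers it to `ι`.
    refine (ih h1 ((gePos_gtNeg_mono (h2 ▸ hσ.ge_target) ρ).1 hpos) fun x hx =>
      hFV x ?_).imp_left (FnAccSub.fn hi hsi)
    exact (FV_apps _ _ x).2 (Or.inr ⟨s, List.mem_of_getElem? hsi, hx⟩)
  | @vr x ss i s t hi hsi hst _ =>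
    obtain ⟨ρ, hρ, hpos⟩ := hi
    obtain ⟨h1, h2⟩ := hs.arg (.fvar x) hsi hρ
    obtain ⟨τ, h3, h4⟩ := hst.target_ge h1
    -- The strict drop occurs at the head variable; the rest of the path only preserves or lowers
    -- the sort.
    have hx := (hFV x ((FV_apps _ _ x).2 (Or.inl rfl))).gt_target
    exact Or.inr ⟨τ, h3, F.gt_of_gt_of_ge hx (F.ge_trans _ _ _ hpos h4)⟩

/-- Each meta-variable takes as many arguments as its minimal arity, and these are distinct bound or
free variables. -/
def Tm.MetaArgsDistinct : Tm F → Prop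
  | app s t => s.MetaArgsDistinct ∧ t.MetaArgsDistinct
  | lam _ s => s.MetaArgsDistinct
  | mapp Z e a => e = F.mvAr Z ∧ Function.Injective a ∧
      ∀ i, (∃ n, a i = bvar n) ∨ ∃ x, a i = fvar x
  | _ => True

theorem Tm.metaArgsDistinct_apps {a : Tm F} {ss : List (Tm F)} :
    (apps a ss).MetaArgsDistinct ↔ a.MetaArgsDistinct ∧ ∀ s ∈ ss, s.MetaArgsDistinct := by
  induction ss generalizing a with
  | nil => simp
  | cons t ts ih => rw [apps_cons, ih]; simp [MetaArgsDistinct, and_assoc]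

theorem Tm.instAux_fvar_bvar (x : F.Vr) (k n : ℕ) :
    instAux [fvar x] k (bvar n) =
      if n < k then bvar n else if n = k then fvar x else bvar (n - 1) := by
  simp only [instAux]
  split_ifs with h1 h2
  · rfl
  · subst h2; simp [lift]
  · obtain ⟨m, hm⟩ : ∃ m, n - k = m + 1 := ⟨n - k - 1, by omega⟩
    simp [hm]

/-- Opening is injective on variables and indices when `x` is fresh, so distinct arguments stay
distinct. -/
theorem Tm.metaArgsDistinct_opn {u : Tm F} {x : F.Vr} (hx : x ∉ u.FV) (k : ℕ) :
    (instAux [fvar x] k u).MetaArgsDistinct ↔ u.MetaArgsDistinct := by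
  induction u generalizing k with
  | bvar n =>
    rw [instAux_fvar_bvar]
    split_ifs <;> simp [MetaArgsDistinct]
  | fvar y => rfl
  | fn f => rfl
  | app s t ihs iht =>
    simp only [instAux, MetaArgsDistinct]
    rw [ihs fun h => hx (Or.inl h), iht fun h => hx (Or.inr h)]
  | lam σ s ih => exact ih hx (k + 1)
  | mapp Z e a ih =>
    simp only [instAux, MetaArgsDistinct]
    refine and_congr_right fun _ => ⟨fun ⟨h1, h2⟩ => ⟨fun i j h => h1 (by simp only [h]),
      fun i => ?_⟩, fun ⟨h1, h2⟩ => ⟨fun i j h => h1 ?_, fun i => ?_⟩⟩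
    · have := h2 i
      cases h : a i <;> simp_all [instAux]
    · have hi : x ∉ (a i).FV := fun h => hx (Set.mem_iUnion.2 ⟨i, h⟩)
      have hj : x ∉ (a j).FV := fun h => hx (Set.mem_iUnion.2 ⟨j, h⟩)
      simp only at h
      rcases h2 i with ⟨n, h3⟩ | ⟨y, h3⟩ <;> rcases h2 j with ⟨m, h4⟩ | ⟨z, h4⟩ <;>
        rw [h3, h4] at h ⊢
      · rw [instAux_fvar_bvar, instAux_fvar_bvar] at h
        congr 1
        split_ifs at h <;> first | omega | (cases h; done) | (cases h; rfl) | (injection h; omega)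
      · rw [h4] at hj
        rw [instAux_fvar_bvar] at h
        split_ifs at h <;> cases h
        exact absurd rfl hj
      · rw [h3] at hi
        rw [instAux_fvar_bvar] at h
        split_ifs at h <;> cases h
        exact absurd rfl hi
      · exact h
    · rcases h2 i with ⟨n, h3⟩ | ⟨y, h3⟩ <;> rw [h3]
      · rw [instAux_fvar_bvar]
        split_ifs <;> simp
      · exact Or.inr ⟨y, rfl⟩

theorem Tm.IsPattern.metaArgsDistinct {s : Tm F} (h : IsPattern s) : s.MetaArgsDistinct := by
  induction h with
  | mapp Z x hx =>
    exact ⟨rfl, fun i j h => hx (Tm.fvar.inj h), fun i => Or.inr ⟨x i, rfl⟩⟩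
  | lam x _ hxu _ ih => exact (metaArgsDistinct_opn hxu 0).1 ih
  | app ha _ ih =>
    refine metaArgsDistinct_apps.2 ⟨?_, ih⟩
    rcases ha with ⟨f, rfl⟩ | ⟨x, rfl⟩ <;> trivial

theorem AccSub.metaArgsDistinct {s t : Tm F} (h : AccSub s t) (hs : s.MetaArgsDistinct) :
    t.MetaArgsDistinct := by
  induction h with
  | refl => exact hs
  | lam x _ hxu _ ih => exact ih ((metaArgsDistinct_opn hxu 0).2 hs)
  | fn _ hsi _ ih => exact ih ((metaArgsDistinct_apps.1 hs).2 _ (List.mem_of_getElem? hsi))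
  | vr _ hsi _ ih => exact ih ((metaArgsDistinct_apps.1 hs).2 _ (List.mem_of_getElem? hsi))

/-! ### From accessible subterms to reductions -/

section

variable {S : Set (Rule F)}

/-- The union of `→_S` and `⇛_C`. -/
def CompSet.Red (C : CompSet S) (s t : Tm F) : Prop := Step S s t ∨ AccReduce C.C s t

theorem CompSet.reflTransGen_of_steps (C : CompSet S) {s t : Tm F} (h : Steps S s t) :
    Relation.ReflTransGen C.Red s t := by
  induction h with
  | refl => exact .refl
  | tail _ h ih => exact ih.tail (Or.inl h)

/-- The arguments `ts` are built backwards along the path from `us`: an abstraction prepends the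
value of its bound variable, and a function symbol may take any computable arguments, since `⇛_C`
discards them. -/
theorem FnAccSub.reduces (C : CompSet S) {γ : Subst F}
    (hv : ∀ x, CompAt C.C (F.vrTy x) (γ.v x)) (hm : ∀ Z, HasType [] (γ.m Z) (F.mvTy Z))
    {s t : Tm F} (h : FnAccSub s t) {σ : Ty F.Srt} (hs : HasType [] s σ)
    (hM : ∀ Z ∈ s.FMV, (γ.m Z).FMV = ∅) {us : List (Tm F)} (hus : ∀ u ∈ us, Comp C.C u)
    (hb : ∃ κ, (apps (t.subst γ) us).IsTermOf (.base κ)) :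
    ∃ ts, (∀ u ∈ ts, Comp C.C u) ∧ (∃ κ, (apps (s.subst γ) ts).IsTermOf (.base κ)) ∧
      Relation.ReflTransGen C.Red (apps (s.subst γ) ts) (apps (t.subst γ) us) := by
  have hvt : ∀ x, HasType [] (γ.v x) (F.vrTy x) := fun x => (hv x).isTermOf.1
  have hvf : ∀ x, (γ.v x).FMV = ∅ := fun x => (hv x).isTermOf.2
  induction h generalizing σ with
  | refl s => exact ⟨us, hus, hb, .refl⟩
  | @lam ρ u t x hx _ ih =>
    subst hx
    cases hs with
    | @lam _ _ _ τ hs =>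
      obtain ⟨ts, h1, ⟨κ, h2⟩, h3⟩ := ih hs.opn (by rwa [opn, inst, FMV_opn]) hb
      rw [subst_opn (fun y => (hvt y).lc) (fun Z => (hm Z).lc)] at h2 h3
      -- Contracting with `γ(x)` yields exactly the instance of the opened body.
      refine ⟨γ.v x :: ts, ?_, ⟨κ, ?_⟩, .head (Or.inl ((Step.beta _ _ _).apps ts)) h3⟩
      · simpa using ⟨⟨_, hv x⟩, h1⟩
      · obtain ⟨σs, h4, h5⟩ := isTermOf_apps.1 h2
        have h6 := HasType.subst hvt hm hs.opn
        rw [subst_opn (fun y => (hvt y).lc) (fun Z => (hm Z).lc)] at h6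
        obtain rfl := h4.1.unique h6
        refine isTermOf_apps.2 ⟨F.vrTy x :: σs, ⟨?_, ?_⟩, .cons (hv x).isTermOf h5⟩
        · exact HasType.subst hvt hm (.lam hs)
        · exact FMV_subst (fun y _ => hvf y) hM
  | @fn f ss i s t hi hsi _ ih =>
    obtain ⟨ρ, hρ, hpos⟩ := id hi
    have hmem := List.mem_of_getElem? hsi
    obtain ⟨ts, h1, h2, h3⟩ := ih (hs.arg (.fn f) hsi hρ).1
      (fun Z hZ => hM Z ((FMV_apps _ _ Z).2 (Or.inr ⟨s, hmem, hZ⟩))) hb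
    obtain ⟨ws, hws⟩ := exists_compAt_list C.isRC σ.argTys
    have hb' : (apps ((apps (Tm.fn f) ss).subst γ) ws).IsTermOf (.base σ.target) := by
      refine isTermOf_apps.2 ⟨σ.argTys, ⟨?_, FMV_subst (fun y _ => hvf y) hM⟩,
        hws.imp fun _ _ h => h.isTermOf⟩
      rw [arrows_argTys_target]
      exact HasType.subst hvt hm hs
    refine ⟨ws, ?_, ⟨_, hb'⟩, .head (Or.inr ⟨⟨_, hb'⟩, h2, f, ss.map (Tm.subst γ) ++ ws, i,
      s.subst γ, ts, ?_, hi, ?_, h1, rfl⟩) h3⟩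
    · intro w hw
      obtain ⟨j, hj, rfl⟩ := List.getElem_of_mem hw
      exact ⟨_, List.Forall₂.get hws hj (hws.length_eq ▸ hj)⟩
    · rw [subst_apps, apps_append]; rfl
    · have hlt := (List.getElem?_eq_some_iff.1 hsi).1
      rw [List.getElem?_append_left (by simpa using hlt), List.getElem?_map, hsi]
      rfl

/-- At base type a nontrivial path cannot start with an abstraction, so it starts with a genuine
`⇛_C` step that needs no added arguments. -/
theorem FnAccSub.eq_or_transGen (C : CompSet S) {γ : Subst F}
    (hv : ∀ x, CompAt C.C (F.vrTy x) (γ.v x)) (hm : ∀ Z, HasType [] (γ.m Z) (F.mvTy Z))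
    {s t : Tm F} (h : FnAccSub s t) {ι : F.Srt} (hs : HasType [] s (.base ι))
    (hM : ∀ Z ∈ s.FMV, (γ.m Z).FMV = ∅) {us : List (Tm F)} (hus : ∀ u ∈ us, Comp C.C u)
    (hb : ∃ κ, (apps (t.subst γ) us).IsTermOf (.base κ)) :
    s = t ∨ Relation.TransGen C.Red (s.subst γ) (apps (t.subst γ) us) := by
  cases h with
  | refl => exact Or.inl rfl
  | lam => cases hs
  | @fn f ss i s _ hi hsi h =>
    obtain ⟨ρ, hρ, hpos⟩ := id hi
    have hmem := List.mem_of_getElem? hsi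
    obtain ⟨ts, h1, h2, h3⟩ := h.reduces C hv hm (hs.arg (.fn f) hsi hρ).1
      (fun Z hZ => hM Z ((FMV_apps _ _ Z).2 (Or.inr ⟨s, hmem, hZ⟩))) hus hb
    refine Or.inr (.head' (Or.inr ⟨⟨ι, HasType.subst (fun x => (hv x).isTermOf.1) hm hs,
      FMV_subst (fun y _ => (hv y).isTermOf.2) hM⟩, h2, f, ss.map (Tm.subst γ), i, s.subst γ, ts,
      ?_, hi, ?_, h1, rfl⟩) h3)
    · rw [subst_apps]; rfl
    · rw [List.getElem?_map, hsi]; rfl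

-- Arguments that a meta-variable disregards

theorem exists_fresh_vars (σs : List (Ty F.Srt)) {A : Set F.Vr} (hA : A.Finite) :
    ∃ xs : List F.Vr, xs.Nodup ∧ (∀ x ∈ xs, x ∉ A) ∧ xs.map F.vrTy = σs := by
  induction σs generalizing A with
  | nil => exact ⟨[], by simp⟩
  | cons σ σs ih =>
    obtain ⟨x, hx, hxA⟩ := (F.vr_infinite σ).exists_notMem_finite hA
    obtain ⟨xs, h1, h2, h3⟩ := ih (hA.insert x)
    refine ⟨x :: xs, List.nodup_cons.2 ⟨fun h => h2 x h (Or.inl rfl), h1⟩, ?_, ?_⟩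
    · simpa using ⟨hxA, fun y hy hyA => h2 y hy (Or.inr hyA)⟩
    · rw [List.map_cons, h3]; exact congrArg (· :: σs) hx

/-- Replacing arguments of a meta-variable that its value disregards by variables makes all of them
computable without changing the instance. -/
theorem exists_comp_args {C : CompSet S} {γ : Subst F} {Z : F.Mv}
    (hZ : HasType [] (γ.m Z) (F.mvTy Z)) (hZf : (γ.m Z).FMV = ∅) {e : ℕ} (he : F.mvAr Z ≤ e)
    {σs : Fin e → Ty F.Srt} {τ : Ty F.Srt} (hty : F.mvTy Z = arrows (List.ofFn σs) τ)
    (b : Fin e → Tm F) (hb : ∀ i, HasType [] (b i) (σs i))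
    (hc : ∀ i : Fin e, γ.Respects {(Z, (i : ℕ))} → Comp C.C (b i)) :
    ∃ c : Fin e → Tm F, (∀ i, CompAt C.C (σs i) (c i)) ∧
      develop (γ.m Z) [] (List.ofFn c) = develop (γ.m Z) [] (List.ofFn b) := by
  classical
  obtain ⟨xs, hnd, hfr, hxs⟩ := exists_fresh_vars (List.ofFn σs) (γ.m Z).FV_finite
  obtain ⟨y, rfl⟩ : ∃ y : Fin e → F.Vr, xs = List.ofFn y := by
    have hl : xs.length = e := by simpa using congrArg List.length hxs
    subst hl
    exact ⟨xs.get, (List.ofFn_get xs).symm⟩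
  have hy : Function.Injective y := List.nodup_ofFn.1 hnd
  have hyt : ∀ i, F.vrTy (y i) = σs i := by
    rw [List.map_ofFn] at hxs
    exact congrFun (List.ofFn_injective hxs)
  have hyf : ∀ i, y i ∉ (γ.m Z).FV := fun i => hfr _ (List.mem_ofFn.2 ⟨i, rfl⟩)
  set w := develop (γ.m Z) [] ((List.ofFn y).map fvar) with hw
  -- `θ` inserts all original arguments into the template `w`; `η` inserts only those whose variable
  -- occurs in `w`. The new arguments are the values of `η`.
  let θ : Subst F := ⟨Function.extend y b fvar, etaMeta⟩
  let η : Subst F := ⟨fun x => if x ∈ w.FV then θ.v x else fvar x, etaMeta⟩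
  have hθy : ∀ i, θ.v (y i) = b i := fun i => hy.extend_apply b fvar i
  have hθt : ∀ x, HasType [] (θ.v x) (F.vrTy x) := by
    intro x
    by_cases hx : ∃ i, y i = x
    · obtain ⟨i, rfl⟩ := hx
      rw [hθy, hyt]; exact hb i
    · rw [show θ.v x = fvar x from Function.extend_apply' b fvar x hx]; exact .fvar x
  have hθf : ∀ x ∈ (γ.m Z).FV, θ.v x = fvar x := fun x hx =>
    Function.extend_apply' b fvar x fun ⟨i, hi⟩ => hyf i (hi ▸ hx)
  have hηf : ∀ x ∈ (γ.m Z).FV, η.v x = fvar x := by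
    intro x hx
    simp only [η]
    split_ifs
    exacts [hθf x hx, rfl]
  have hηl : ∀ x, LC 0 (η.v x) := by
    intro x
    simp only [η]
    split_ifs
    exacts [(hθt x).lc, trivial]
  have hwθ := subst_develop_vars (fun x => (hθt x).lc) (γ.m Z) [] (List.ofFn y) hZf hθf
  have hwη := subst_develop_vars hηl (γ.m Z) [] (List.ofFn y) hZf hηf
  refine ⟨fun i => η.v (y i), fun i => ?_, ?_⟩
  · by_cases hi : y i ∈ w.FV
    · have : η.v (y i) = b i := (if_pos hi).trans (hθy i)
      simp only [this]
      refine (hc i ?_).compAt (hb i)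
      rintro Z' j hj
      obtain ⟨rfl, rfl⟩ := Prod.mk.inj (Set.mem_singleton_iff.1 hj)
      -- An occurrence of `y i` in the template is precisely a witness that `γ` respects the
      -- condition `(Z, i)`.
      refine ⟨List.ofFn y, w, y i, ⟨hnd, hfr, ?_, by simpa using he, hw⟩, by simp, hi⟩
      rw [hxs, hty, argTys_arrows]
      exact List.prefix_append _ _
    · have : η.v (y i) = fvar (y i) := if_neg hi
      simp only [this]
      rw [← hyt]
      exact compAt_fvar C.isRC (y i)
  · have h1 : w.subst η = w.subst θ := subst_congr (fun x hx => if_pos hx) rfl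
    simp only [List.map_nil, List.map_ofFn] at hwθ hwη
    simp only [hw, List.map_ofFn] at h1
    rw [hwθ, hwη] at h1
    rw [show b = θ.v ∘ y from funext fun i => (hθy i).symm]
    exact h1

end

/-! ### The decrease along a dependency pair -/

section

variable {S : Set (Rule F)}

theorem forall₂_ofFn {α β : Type*} {r : α → β → Prop} {n : ℕ} {f : Fin n → α} {g : Fin n → β}
    (h : ∀ i, r (f i) (g i)) : List.Forall₂ r (List.ofFn f) (List.ofFn g) :=
  List.forall₂_iff_get.2 ⟨by simp, fun i h1 h2 => by simpa using h _⟩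

/-- The hypothesis `hc` is what computability of a chain provides: instances of the arguments of `Z`
that `γ(Z)` uses, and of all further arguments, are computable. -/
theorem StaticGt.decrease (C : CompSet S) {γ : Subst F}
    (hv : ∀ x, CompAt C.C (F.vrTy x) (γ.v x)) (hm : ∀ Z, HasType [] (γ.m Z) (F.mvTy Z))
    {u v : Tm F} (hMu : ∀ Z ∈ u.FMV, (γ.m Z).FMV = ∅) (hMv : ∀ Z ∈ v.FMV, (γ.m Z).FMV = ∅)
    (hu : u.FV = ∅) (hd : u.MetaArgsDistinct)
    (hc : ∀ Z e a ss, v = apps (mapp Z e a) ss →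
      (∀ i : Fin e, γ.Respects {(Z, (i : ℕ))} → Comp C.C ((a i).subst γ)) ∧
        ∀ s ∈ ss, Comp C.C (s.subst γ))
    (h : StaticGt u v) {ι κ : F.Srt} (hι : HasType [] u (.base ι)) (hκ : HasType [] v (.base κ)) :
    F.gt ι κ ∨ F.ge ι κ ∧ Relation.TransGen C.Red (u.subst γ) (v.subst γ) := by
  have hvt : ∀ x, HasType [] (γ.v x) (F.vrTy x) := fun x => (hv x).isTermOf.1
  have hvγ : (v.subst γ).IsTermOf (.base κ) :=
    ⟨HasType.subst hvt hm hκ, FMV_subst (fun x _ => (hv x).isTermOf.2) hMv⟩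
  have hpos : GePos ι (.base ι) := by simp only [GePos]; exact F.ge_refl ι
  have hno : ∀ x ∈ u.FV, GtNeg ι (F.vrTy x) := by simp [hu]
  obtain ⟨-, -, hne, h | ⟨Z, k, x, e, a, ss, h, rfl⟩⟩ := h
  · obtain ⟨τ, hτ, hge⟩ := h.target_ge hι
    obtain rfl := hτ.unique hκ
    rcases h.fnAccSub_or_gt hι hpos hno with hf | ⟨τ', hτ', hgt⟩
    · rcases hf.eq_or_transGen C hv hm hι hMu (us := []) (by simp) ⟨κ, hvγ⟩ with heq | hr
      · exact absurd heq hne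
      · exact Or.inr ⟨hge, hr⟩
    · obtain rfl := hτ'.unique hκ
      exact Or.inl hgt
  · obtain ⟨hk, hinj, -⟩ := h.metaArgsDistinct hd
    replace hinj : Function.Injective x := fun i j hij => hinj (congrArg fvar hij)
    obtain ⟨hca, hcs⟩ := hc Z e a ss rfl
    obtain ⟨ρs, hZe, hss⟩ := hasType_apps.1 hκ
    obtain ⟨τ, hτ, hge⟩ := h.target_ge hι
    cases hZe with
    | mapp σs he hZe ha =>
    cases id hτ with
    | mapp σk _ hZk hxk =>
    have hZM : (γ.m Z).FMV = ∅ := hMv Z ((FMV_apps _ _ Z).2 (Or.inl (Or.inl rfl)))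
    have hke : k ≤ e := hk ▸ he
    have hty := hZk.symm.trans hZe
    have hτκ : τ.target = κ := by
      have := congrArg Ty.target hty
      rwa [target_arrows, target_arrows, target_arrows] at this
    rcases h.fnAccSub_or_gt hι hpos hno with hf | ⟨τ', hτ', hgt⟩
    swap
    · obtain rfl := hτ'.unique hτ
      exact Or.inl (hτκ ▸ hgt)
    refine Or.inr ⟨hτκ ▸ hge, ?_⟩
    -- Both applications of `Z` split the same declared type, so `x` has the first `k` argument
    -- types, and `τ` takes the remaining ones.
    rw [← List.take_append_drop k (List.ofFn σs), arrows_append] at hty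
    obtain ⟨hσ, hτe⟩ := arrows_inj (by simp [hke]) hty
    obtain ⟨c, hcc, hdev⟩ := exists_comp_args (C := C) (γ := γ) (hm Z) hZM he hZe
      (fun i => (a i).subst γ) (fun i => HasType.subst hvt hm (ha i)) hca
    have hcomp := forall₂_ofFn (r := fun t σ => CompAt C.C σ t) hcc
    have hxt : ∀ j, F.vrTy (x j) = σs (Fin.castLE hke j) := by
      intro j
      rw [(HasType.fvar (x j)).unique (hxk j)]
      have := congrArg (fun l => l[(j : ℕ)]?) hσ
      simp only [List.getElem?_take, List.getElem?_ofFn, j.2, j.2.trans_le hke, if_true, dite_true,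
        Option.some.injEq] at this
      exact this
    -- `θ` agrees with `γ` on meta-variables but sends the variables on the path to the first `k`
    -- computable arguments; it is well defined because the `x j` are distinct.
    let θ : Subst F := ⟨Function.extend x (fun j => c (Fin.castLE hke j)) fvar, γ.m⟩
    have hθx : ∀ j, θ.v (x j) = c (Fin.castLE hke j) := fun j => 
      hinj.extend_apply (fun j => c (Fin.castLE hke j)) fvar j
    have hθ : ∀ y, CompAt C.C (F.vrTy y) (θ.v y) := by
      intro y
      by_cases hy : ∃ j, x j = y
      · obtain ⟨j, rfl⟩ := hy
        rw [hθx, hxt]; exact hcc _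
      · rw [show θ.v y = fvar y from
          Function.extend_apply' (fun j => c (Fin.castLE hke j)) fvar y hy]
        exact compAt_fvar C.isRC y
    have hZθ : (mapp Z k fun i => fvar (x i)).subst θ =
        develop (γ.m Z) [] ((List.ofFn c).take k) := by
      simp only [Tm.subst, hθx]
      congr 1
      apply List.ext_getElem <;> simp [hke]
    have hus : ∀ w ∈ (List.ofFn c).drop k ++ ss.map (Tm.subst γ), Comp C.C w := by
      intro w hw
      rcases List.mem_append.1 hw with hw | hw
      · obtain ⟨i, rfl⟩ := List.mem_ofFn.1 (List.mem_of_mem_drop hw)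
        exact ⟨_, hcc i⟩
      · obtain ⟨s, hs, rfl⟩ := List.mem_map.1 hw
        exact hcs s hs
    have hb : (apps ((mapp Z k fun i => fvar (x i)).subst θ)
        ((List.ofFn c).drop k ++ ss.map (Tm.subst γ))).IsTermOf (.base κ) := by
      refine isTermOf_apps.2 ⟨(List.ofFn σs).drop k ++ ρs, ⟨?_, ?_⟩, ?_⟩
      · rw [arrows_append, ← hτe]
        exact HasType.subst (fun y => (hθ y).isTermOf.1) hm hτ
      · refine FMV_subst (fun y _ => (hθ y).isTermOf.2) ?_
        simpa [FMV] using hZM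
      · refine List.rel_append ((List.forall₂_drop k hcomp).imp fun _ _ h => h.isTermOf) ?_
        rw [List.forall₂_map_left_iff]
        refine List.forall₂_iff_get.2 ⟨hss.length_eq, fun i h1 h2 => ?_⟩
        exact ((hcs _ (List.get_mem _ _)).compAt
          (HasType.subst hvt hm (List.Forall₂.get hss h1 h2))).isTermOf
    rcases hf.eq_or_transGen C hθ hm hι hMu hus ⟨κ, hb⟩ with heq | hr
    · exfalso
      subst heq
      -- An empty path makes `u` itself `Z⟨x₁,…,xₖ⟩`. Closedness gives `k = 0`, base type leaves no
      -- room for further arguments, and `v` would equal `u`.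
      have hk0 : k = 0 := by
        by_contra hk0
        have : x ⟨0, Nat.pos_of_ne_zero hk0⟩ ∈ (∅ : Set F.Vr) :=
          hu ▸ Set.mem_iUnion.2 ⟨⟨0, Nat.pos_of_ne_zero hk0⟩, rfl⟩
        exact this
      subst hk0
      obtain rfl := hτ.unique hι
      rw [← arrows_append, List.drop_zero] at hτe
      have hl := congrArg (fun σ => σ.argTys.length) hτe
      simp only [argTys_arrows, argTys, List.length_append, List.length_ofFn, List.length_nil] at hl
      obtain rfl : e = 0 := by omega
      have hs0 : ss = [] := List.length_eq_zero_iff.1 (by rw [hss.length_eq]; omega)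
      subst hs0
      exact hne (by rw [apps_nil]; congr 1; funext i; exact i.elim0)
    · have huθ : u.subst θ = u.subst γ := subst_congr (by simp [hu]) rfl
      rw [huθ, hZθ, apps_append] at hr
      have hlc : ∀ w ∈ List.ofFn c, LC 0 w := by
        intro w hw
        obtain ⟨i, rfl⟩ := List.mem_ofFn.1 hw
        exact (hcc i).isTermOf.1.lc
      have hst := (steps_develop S (γ.m Z) [] ((List.ofFn c).take k) ((List.ofFn c).drop k) (by simp)
        (fun w hw => hlc w (List.mem_of_mem_take hw))
        (fun w hw => hlc w (List.mem_of_mem_drop hw))).apps (ss.map (Tm.subst γ))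
      rw [List.take_append_drop, hdev] at hst
      rw [subst_apps]
      exact Relation.TransGen.trans_left hr (C.reflTransGen_of_steps hst)

-- Well-founded descent inside an RC-set

theorem IsRCSet.steps_mem {I : Set (Tm F)} (hI : IsRCSet S I) {R : Set (Rule F)}
    (hR : ∀ s t : Tm F, s.IsTerm → Step R s t → Step S s t) {s t : Tm F} (h : Steps R s t)
    {κ : F.Srt} (hs : s.IsTermOf (.base κ)) (hsI : s ∈ I) :
    Steps S s t ∧ t.IsTermOf (.base κ) ∧ t ∈ I := by
  induction h with
  | refl => exact ⟨.refl, hs, hsI⟩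
  | tail _ h ih =>
    obtain ⟨h1, h2, h3⟩ := ih
    have h4 := hR _ _ ⟨_, h2⟩ h
    exact ⟨h1.tail h4, h4.isTermOf h2, hI.closed _ h3 _ h4⟩

/-- Outer induction on the sort, inner induction on `C.Red`. Once strict drops of the sort are
excluded by the outer hypothesis, infinitely many proper reductions remain from a term of `C`. -/
theorem CompSet.no_descent (C : CompSet S) (A : ℕ → Tm F) (Q : ℕ → Prop)
    (hQ : ∀ N, ∃ i ≥ N, Q i)
    (step : ∀ i κ, (A i).IsTermOf (.base κ) → A i ∈ C.C →
      ∃ κ', (A (i + 1)).IsTermOf (.base κ') ∧ A (i + 1) ∈ C.C ∧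
        (F.gt κ κ' ∨ F.ge κ κ' ∧ Relation.ReflTransGen C.Red (A i) (A (i + 1)) ∧
          (Q i → Relation.TransGen C.Red (A i) (A (i + 1))))) :
    ∀ κ i, (A i).IsTermOf (.base κ) → A i ∉ C.C := by
  intro κ
  induction κ using F.gt_wf.induction with
  | _ κ ih =>
  -- Here `m` is the distance to an index satisfying `Q`. The sort is only kept weakly below `κ`,
  -- since it may change within an equivalence class of the quasi-ordering.
  have next : ∀ m i κ', F.ge κ κ' → (A i).IsTermOf (.base κ') → A i ∈ C.C → Q (i + m) →
      ∃ j κ'', F.ge κ κ'' ∧ (A j).IsTermOf (.base κ'') ∧ A j ∈ C.C ∧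
        Relation.TransGen C.Red (A i) (A j) := by
    intro m
    induction m with
    | zero =>
      intro i κ' hκ hi hiC hq
      obtain ⟨κ'', h1, h2, h3 | ⟨h3, -, h4⟩⟩ := step i κ' hi hiC
      · exact absurd h2 (ih κ'' (F.gt_of_ge_of_gt hκ h3) (i + 1) h1)
      · exact ⟨i + 1, κ'', F.ge_trans _ _ _ hκ h3, h1, h2, h4 hq⟩
    | succ m ihm =>
      intro i κ' hκ hi hiC hq
      obtain ⟨κ'', h1, h2, h3 | ⟨h3, h4, -⟩⟩ := step i κ' hi hiC
      · exact absurd h2 (ih κ'' (F.gt_of_ge_of_gt hκ h3) (i + 1) h1)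
      · obtain ⟨j, μ, h5, h6, h7, h8⟩ := ihm (i + 1) κ'' (F.ge_trans _ _ _ hκ h3) h1 h2
          (by rwa [Nat.add_right_comm])
        exact ⟨j, μ, h5, h6, h7, Relation.TransGen.trans_right h4 h8⟩
  have main : ∀ a, Acc (Relation.TransGen fun s t => C.Red t s) a → ∀ i κ', F.ge κ κ' →
      (A i).IsTermOf (.base κ') → A i ∈ C.C → A i ≠ a := by
    intro a ha
    induction ha with
    | intro a _ iha =>
      rintro i κ' hκ hi hiC rfl
      obtain ⟨n, hn, hq⟩ := hQ i
      obtain ⟨j, μ, h1, h2, h3, h4⟩ := next (n - i) i κ' hκ hi hiC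
        (by rwa [Nat.add_sub_cancel' hn])
      exact iha (A j) (Relation.transGen_swap.2 h4) j μ h1 h2 h3 rfl
  intro i hi hiC
  exact main (A i) (acc_of_terminatingAt ((C.mem_iff _).1 hiC).2.1).transGen i κ (F.ge_refl κ)
    hi hiC rfl

/-! ### Projections of the steps of a computable chain -/

theorem proj_apps_fn (ν : F.Fn → ℕ) (f : F.Fn) (ss : List (Tm F)) :
    proj ν (apps (fn f) ss) = ss[ν f]? := by
  simp [proj, head_apps, args_apps, head, args]

theorem exists_of_proj_eq_some {ν : F.Fn → ℕ} {s u : Tm F} (h : proj ν s = some u) :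
    ∃ f ss, s = apps (fn f) ss ∧ ss[ν f]? = some u := by
  cases hs : s.head with
  | fn f =>
    refine ⟨f, s.args, by rw [← hs, apps_head_args], ?_⟩
    simpa [proj, hs] using h
  | _ => simp [proj, hs] at h

theorem proj_subst {ν : F.Fn → ℕ} {s u : Tm F} (h : proj ν s = some u) (γ : Subst F) :
    proj ν (s.subst γ) = some (u.subst γ) := by
  obtain ⟨f, ss, rfl, hu⟩ := exists_of_proj_eq_some h
  rw [subst_apps]
  exact (proj_apps_fn ν f _).trans (by rw [List.getElem?_map, hu]; rfl)

theorem Tm.IsPattern.metaArgsDistinct_of_mem {f : F.Fn} {ls : List (Tm F)} {l : Tm F}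
    (h : IsPattern (apps (fn f) ls)) (hl : l ∈ ls) : l.MetaArgsDistinct :=
  (metaArgsDistinct_apps.1 h.metaArgsDistinct).2 l hl

/-- A chain step maps every variable to a variable: a fresh one on the free variables of `p`, itself
elsewhere. -/
theorem DPStep.compAt_v {C : CompSet S} {d : DP F} {s t : Tm F} {γ : Subst F}
    (h : DPStep d s t γ) (x : F.Vr) : CompAt C.C (F.vrTy x) (γ.v x) := by
  have hx := h.isSubst.1.1 x
  obtain ⟨y, hy⟩ : ∃ y, γ.v x = fvar y := by
    by_cases hd : x ∈ d.rhs.FV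
    · obtain ⟨y, hy, -⟩ := h.fresh x hd; exact ⟨y, hy⟩
    · rw [← h.domV] at hd
      exact ⟨x, not_not.1 hd⟩
  rw [hy] at hx ⊢
  rw [← (HasType.fvar y).unique hx]
  exact compAt_fvar C.isRC y

theorem DPStep.comp_of_bSub {C : CompSet S} {d : DP F} {s t : Tm F} {γ : Subst F}
    (h : DPStep d s t γ)
    (hc : ∀ v B, BSub B d.rhs v → γ.Respects B → ∀ xs : List F.Vr, xs.Nodup →
      {x | x ∈ xs} = v.FV → Comp C.C ((absList xs v).subst γ))
    {v : Tm F} {B : Set (F.Mv × ℕ)} (hv : BSub B d.rhs v) (hB : γ.Respects B) {τ : Ty F.Srt}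
    (hτ : HasType [] v τ) : Comp C.C (v.subst γ) := by
  refine Comp.of_absList C.isRC h.compAt_v (fun Z => (h.isSubst.1.2 Z).1.lc)
    v.FV_finite.toFinset.toList hτ.lc (hc v B hv hB _ (Finset.nodup_toList _) ?_)
  ext x
  simp

theorem Subst.respects_empty (γ : Subst F) : γ.Respects ∅ := fun _ _ h => absurd h (Set.notMem_empty _)

end

/-- The static subterm criterion: the removed pairs occur only finitely often in a chain. -/
theorem IsComputableChain.eventually_notMem {P₁ P₂ : Set (DP F)} {R S : Set (Rule F)}
    {C : CompSet S} {c : ChainData F} (hc : IsChain (P₁ ∪ P₂) R c)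
    (hcomp : IsComputableChain R S C.C c) (ν : F.Fn → ℕ)
    (h₁ : ∀ d ∈ P₁, ∃ u v, proj ν d.lhs = some u ∧ proj ν d.rhs = some v ∧ StaticGt u v)
    (h₂ : ∀ d ∈ P₂, proj ν d.lhs = proj ν d.rhs)
    (hν : IsProjection ν (P₁ ∪ P₂)) :
    ∃ N, ∀ i ≥ N, ∀ d, c.ρ i = some d → d ∉ P₁ := by
  obtain ⟨hRS, hcomp⟩ := hcomp
  -- The default is never taken, since `ν` is defined on both sides of every pair and hence on their
  -- instances.
  let A : ℕ → Tm F := fun i => (proj ν (c.s i)).getD (bvar 0)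
  let B : ℕ → Tm F := fun i => (proj ν (c.t i)).getD (bvar 0)
  let Q : ℕ → Prop := fun i => ∃ d, c.ρ i = some d ∧ d ∈ P₁
  by_contra! hinf
  have hQ : ∀ N, ∃ i ≥ N, Q i := hinf
  have hstep : ∀ i, (Q i ∧ ∃ ι κ, (A i).IsTermOf (.base ι) ∧ (B i).IsTermOf (.base κ) ∧ B i ∈ C.C ∧
      (F.gt ι κ ∨ F.ge ι κ ∧ Relation.TransGen C.Red (A i) (B i))) ∨ (¬ Q i ∧ A i = B i) := by
    intro i
    obtain ⟨d, γ, hρ, hd, ht, hbs⟩ := hcomp i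
    have hdP := hc.mem i d hρ
    obtain ⟨⟨u, hu⟩, v, hv⟩ := hν d hdP
    have hA : A i = u.subst γ := by simp only [A, hd.source, proj_subst hu γ, Option.getD_some]
    have hB : B i = v.subst γ := by simp only [B, ht, proj_subst hv γ, Option.getD_some]
    by_cases hd1 : d ∈ P₁
    swap
    · refine Or.inr ⟨fun ⟨d', h, h'⟩ => hd1 (by rw [hρ] at h; exact Option.some.inj h ▸ h'), ?_⟩
      have := h₂ d (hdP.resolve_left hd1)
      rw [hu, hv] at this
      rw [hA, hB, Option.some.inj this]
    · refine Or.inl ⟨⟨d, hρ, hd1⟩, ?_⟩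
      obtain ⟨u', v', hu', hv', hgt⟩ := h₁ d hd1
      obtain rfl := Option.some.inj (hu.symm.trans hu')
      obtain rfl := Option.some.inj (hv.symm.trans hv')
      obtain ⟨ι, hι⟩ := hgt.1
      obtain ⟨κ, hκ⟩ := hgt.2.1
      obtain ⟨f, ls, hl, hlu⟩ := exists_of_proj_eq_some hu
      obtain ⟨g, rs, hr, hrv⟩ := exists_of_proj_eq_some hv
      have hlu := List.mem_of_getElem? hlu
      have hrv := List.mem_of_getElem? hrv
      have hm : ∀ Z, HasType [] (γ.m Z) (F.mvTy Z) := fun Z => (hd.isSubst.1.2 Z).1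
      have hvc := hd.compAt_v (C := C)
      have hMu : ∀ Z ∈ u.FMV, (γ.m Z).FMV = ∅ := fun Z hZ => hd.isSubst.2.2 Z (by
        rw [hd.domM, hl]; exact Or.inl ((FMV_apps _ _ Z).2 (Or.inr ⟨u, hlu, hZ⟩)))
      have hMv : ∀ Z ∈ v.FMV, (γ.m Z).FMV = ∅ := fun Z hZ => hd.isSubst.2.2 Z (by
        rw [hd.domM, hr]; exact Or.inr ((FMV_apps _ _ Z).2 (Or.inr ⟨v, hrv, hZ⟩)))
      have hFV : u.FV = ∅ := by
        refine Set.eq_empty_iff_forall_notMem.2 fun x hx => ?_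
        refine Set.eq_empty_iff_forall_notMem.1 d.lhs_closed x ?_
        rw [hl]; exact (FV_apps _ _ x).2 (Or.inr ⟨u, hlu, hx⟩)
      have hsub : ∀ {B w}, BSub B v w → BSub B d.rhs w := fun h => by
        rw [hr]; exact .arg nofun hrv h
      have hvγ := hd.comp_of_bSub hbs (hsub (.pre v [])) γ.respects_empty hκ
      have hvt := hvγ.compAt (HasType.subst (fun x => (hvc x).isTermOf.1) hm hκ)
      refine ⟨ι, κ, hA ▸ ⟨HasType.subst (fun x => (hvc x).isTermOf.1) hm hι,
        FMV_subst (fun x _ => (hvc x).isTermOf.2) hMu⟩, hB ▸ hvt.1, hB ▸ hvt.2, ?_⟩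
      rw [hA, hB]
      refine hgt.decrease C hvc hm hMu hMv hFV ((hl ▸ d.lhs_pattern).metaArgsDistinct_of_mem hlu) ?_ hι hκ
      rintro Z e a ss rfl
      obtain ⟨ρs, h1, h2⟩ := hasType_apps.1 hκ
      cases h1 with
      | mapp σs _ _ ha =>
        -- The condition set is the singleton `{(Z, j)}`, which `γ` respects by `hj`; the remaining
        -- arguments need no condition.
        refine ⟨fun j hj => hd.comp_of_bSub hbs (hsub (.mapp j (Set.mem_singleton _)
          (.pre (a j) []))) hj (ha j),
          fun s hs => ?_⟩
        obtain ⟨j, hj, rfl⟩ := List.getElem_of_mem hs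
        exact hd.comp_of_bSub hbs (hsub (.arg nofun hs (.pre _ []))) γ.respects_empty
          (List.Forall₂.get h2 hj (h2.length_eq ▸ hj))
  have hred : ∀ i, Steps R (B i) (A (i + 1)) := by
    intro i
    rcases hc.reduce i with h | ⟨f, us, ws, h1, h2, h3⟩
    · simp only [A, B, h]; exact .refl
    · simp only [A, B, h1, h2, proj_apps_fn]
      by_cases hi : ν f < us.length
      · have hi' : ν f < ws.length := h3.length_eq ▸ hi
        rw [List.getElem?_eq_getElem hi, List.getElem?_eq_getElem hi']
        exact List.Forall₂.get h3 hi hi'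
      · have hi' : ¬ ν f < ws.length := h3.length_eq ▸ hi
        rw [List.getElem?_eq_none (by omega), List.getElem?_eq_none (by omega)]
        exact .refl
  obtain ⟨i₀, -, hi₀⟩ := hQ 0
  rcases hstep i₀ with ⟨-, ι, κ, -, h1, h2, -⟩ | ⟨h, -⟩
  swap
  · exact h hi₀
  -- The first step with a pair of `P₁` places the projected sequence in `C`; from there on every
  -- step keeps it in `C`.
  obtain ⟨-, h3, h4⟩ := C.isRC.steps_mem hRS (hred i₀) h1 h2
  refine C.no_descent A Q hQ (fun i μ hi hiC => ?_) κ (i₀ + 1) h3 h4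
  rcases hstep i with ⟨-, ι', κ', h5, h6, h7, h8⟩ | ⟨hnQ, heq⟩
  · obtain rfl := Ty.base.inj (h5.1.unique hi.1)
    obtain ⟨h9, h10, h11⟩ := C.isRC.steps_mem hRS (hred i) h6 h7
    refine ⟨κ', h10, h11, h8.imp_right fun ⟨h12, h13⟩ => ?_⟩
    have h14 := Relation.TransGen.trans_left h13 (C.reflTransGen_of_steps h9)
    exact ⟨h12, h14.to_reflTransGen, fun _ => h14⟩
  · have := hred i
    rw [← heq] at this
    obtain ⟨h9, h10, h11⟩ := C.isRC.steps_mem hRS this hi hiC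
    exact ⟨μ, h10, h11, Or.inr ⟨F.ge_refl μ, C.reflTransGen_of_steps h9, fun h => absurd h hnQ⟩⟩

/-! ### The processor -/

theorem IsChain.mono {P P' : Set (DP F)} {R : Set (Rule F)} {c : ChainData F} (h : IsChain P R c)
    (hP : P ⊆ P') : IsChain P' R c :=
  { h with mem := fun i d hd => hP (h.mem i d hd) }

/-- A chain over fewer pairs is a chain over more, and neither `R` nor the flags change. -/
theorem DPProblem.IsInfinite.mono {M : DPProblem F} {P : Set (DP F)} (hP : P ⊆ M.P)
    (h : ({ M with P := P } : DPProblem F).IsInfinite) : M.IsInfinite := by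
  refine h.imp_left fun h hfin => h fun ⟨c, h1, h2, h3⟩ => hfin ⟨c, h1.mono hP, h2, h3⟩

/-- The chain without its first `N` steps. -/
def ChainData.drop (c : ChainData F) (N : ℕ) : ChainData F :=
  ⟨fun i => c.ρ (i + N), fun i => c.s (i + N), fun i => c.t (i + N)⟩

theorem IsChain.drop {P P' : Set (DP F)} {R : Set (Rule F)} {c : ChainData F} (h : IsChain P R c)
    {N : ℕ} (hN : ∀ i ≥ N, ∀ d, c.ρ i = some d → d ∈ P') : IsChain P' R (c.drop N) where
  mem i d hd := hN (i + N) (Nat.le_add_left N i) d hd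
  s_term i := h.s_term (i + N)
  t_term i := h.t_term (i + N)
  beta i := h.beta (i + N)
  dp i := h.dp (i + N)
  reduce i := by
    have := h.reduce (i + N)
    rw [Nat.add_right_comm] at this
    exact this

theorem IsComputableChain.drop {R S : Set (Rule F)} {C : Set (Tm F)} {c : ChainData F}
    (h : IsComputableChain R S C c) (N : ℕ) : IsComputableChain R S C (c.drop N) :=
  ⟨h.1, fun i => h.2 (i + N)⟩

theorem IsFormativeChain.drop {R : Set (Rule F)} {c : ChainData F} (h : IsFormativeChain R c)
    (N : ℕ) : IsFormativeChain R (c.drop N) := by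
  intro i d hd
  have := h (i + N) d
  rw [Nat.add_right_comm] at this
  exact this hd

/-- Computability and formativity are conditions on single steps or adjacent pairs of steps, so they
pass to the tail from which no pair of `P₁` occurs. -/
theorem StaticSubtermApplies.isFinite {M : DPProblem F} {P₂ : Set (DP F)}
    (h : StaticSubtermApplies M P₂) (hfin : ({ M with P := P₂ } : DPProblem F).IsFinite) :
    M.IsFinite := by
  obtain ⟨P, R, m, f⟩ := M
  obtain ⟨⟨S, C, rfl⟩, P₁, rfl, -, -, ν, hν, h₁, h₂⟩ := h
  rintro ⟨c, hc, hcomp, hform⟩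
  obtain ⟨N, hN⟩ := IsComputableChain.eventually_notMem hc hcomp ν h₁ h₂ hν
  exact hfin ⟨c.drop N, hc.drop fun i hi d hd => (hc.mem i d hd).resolve_left (hN i hi d hd),
    IsComputableChain.drop hcomp N, fun hf => (hform hf).drop N⟩

end HODP

theorem mainTheorem4 (F : HODP.Framework.{u₁, u₂, u₃, u₄}) (Proc : HODP.Processor F)
    (hProc : HODP.IsStaticSubtermProcessor Proc) : Proc.Sound ∧ Proc.Complete := by
  constructor
  · rintro M ⟨Q, hQ, hfin⟩
    rcases hProc M with ⟨P₂, h, hP⟩ | ⟨-, hP⟩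
    · obtain rfl := Option.some.inj (hP.symm.trans hQ)
      exact h.isFinite (hfin _ rfl)
    · obtain rfl := Option.some.inj (hP.symm.trans hQ)
      exact hfin _ rfl
  · rintro M (hN | ⟨Q, hQ, M', hM', hinf⟩)
    · rcases hProc M with ⟨P₂, -, hP⟩ | ⟨-, hP⟩ <;> exact absurd (hP.symm.trans hN) nofun
    · rcases hProc M with ⟨P₂, ⟨-, P₁, hM, -⟩, hP⟩ | ⟨-, hP⟩
      · obtain rfl := Option.some.inj (hP.symm.trans hQ)
        obtain rfl := Set.mem_singleton_iff.1 hM'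
        exact hinf.mono (hM ▸ Set.subset_union_right)
      · obtain rfl := Option.some.inj (hP.symm.trans hQ)
        obtain rfl := Set.mem_singleton_iff.1 hM'
        exact hinf
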